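/- Let $p$ be a prime, $k$ a field of characteristic $p$, and $G$ a finite group. **Notation.** A finitely generated $kG$-module is a *$p$-permutation module* if its restriction to every $p$-subgroup $P$ of $G$ has a $k$-basis permuted by $P$. A bounded chain complex $C$ of finitely generated $p$-permutation $kG$-modules is *endotrivial* if $C^*\otimes_k C$ is homotopy equivalent to $k[0]$, the trivial module $k$ in degree $0$. Let $\mathcal{E}_k(G)$ be the abelian group of homotopy equivalence classes of endotrivial complexes, with group law induced by $\otimes_k$ (written additively). Let $s_p^{\triangleleft}(G)$ be the poset, under inclusion, of normal $p$-subgroups of $G$ (including the trivial one), and let $\mu$ be its Möbius function. For $P\in s_p^{\triangleleft}(G)$ and a $kG$-module $M$, the *Brauer construction* is the $k[G/P]$-module $$M(P)=M^P\Big/\sum_{Q<P}\operatorname{tr}_Q^P(M^Q),\qquad \operatorname{tr}_Q^P(m)=\sum_{x\in[P/Q]}xm .$$ Applied degreewise it induces a group homomorphism $\operatorname{Def}^G_{G/P}:\mathcal{E}_k(G)\to\mathcal{E}_k(G/P)$, $C\mapsto C(P)$. For $P\le Q$ in $s_p^{\triangleleft}(G)$, inflation (letting $G/P$ act through $G/P\to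 G/Q$, respectively $G$ act through $G\to G/P$) induces group homomorphisms $\operatorname{Inf}^{G/P}_{G/Q}:\mathcal{E}_k(G/Q)\to\mathcal{E}_k(G/P)$ and $\operatorname{Inf}^{G}_{G/P}:\mathcal{E}_k(G/P)\to\mathcal{E}_k(G)$. The *faithful component* of $\mathcal{E}_k(G)$ is the subgroup $$\partial\mathcal{E}_k(G)=\bigcap_{1<P\in s_p^{\triangleleft}(G)}\ker \operatorname{Def}^G_{G/P},$$ which is $\mathcal{E}_k(G)$ if $G$ has no nontrivial normal $p$-subgroup. **Theorem.** Define the group homomorphism $$\Phi:\mathcal{E}_k(G)\to\prod_{P\in s_p^{\triangleleft}(G)}\mathcal{E}_k(G/P),\qquad C\mapsto\Big(\sum_{P\le Q\in s_p^{\triangleleft}(G)}\mu(P,Q)\cdot\operatorname{Inf}^{G/P}_{G/Q}C(Q)\Big)_{P\in s_p^{\triangleleft}(G)} .$$ (a) The image of $\Phi$ is contained in $\prod_{P\in s_p^{\triangleleft}(G)}\partial\mathcal{E}_k(G/P)$. (b) $\Phi:\mathcal{E}_k(G)\to\prod_{P\in s_p^{\triangleleft}(G)}\partial\mathcal{E}_k(G/P)$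 is an isomorphism of groups, with inverse $$\Psi:\prod_{P\in s_p^{\triangleleft}(G)}\partial\mathcal{E}_k(G/P)\to\mathcal{E}_k(G),\qquad (C_P)_{P}\mapsto\sum_{P\in s_p^{\triangleleft}(G)}\operatorname{Inf}^G_{G/P}C_P .$$ -/

import Mathlib

universe u v

namespace EndotrivialComplex

noncomputable section

open CategoryTheory Limits MonoidalCategory

variable {k : Type u} [Field k] {G : Type v} [Group G]

/-! ## Tensor products of chain complexes

The category `Rep k G` is the category of `kG`-modules. Chain complexes are indexed by `ℤ`, with
differentials lowering the degree. -/

/-- The Koszul sign rule for complexes indexed by `ℤ` with differential of degree `-1`: the tensor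
product has the differential `d ⊗ 1 + (-1) ^ i (1 ⊗ d)` on `Cᵢ ⊗ Dⱼ`. -/
instance tensorSignsDown : ComplexShape.TensorSigns (ComplexShape.down ℤ) where
  ε' := MonoidHom.mk' (fun i => Int.negOnePow (Multiplicative.toAdd i))
    (fun a b => Int.negOnePow_add (Multiplicative.toAdd a) (Multiplicative.toAdd b))
  rel_add p q r (hpq : q + 1 = p) := by change q + r + 1 = p + r; lia
  add_rel p q r (hpq : q + 1 = p) := by change r + q + 1 = r + p; lia
  ε'_succ := by
    rintro _ q rfl
    change Int.negOnePow q = - Int.negOnePow (q + 1)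
    rw [Int.negOnePow_succ, neg_neg]

lemma down_ε (i : ℤ) : (ComplexShape.down ℤ).ε i = i.negOnePow := rfl

lemma down_rel (i : ℤ) : (ComplexShape.down ℤ).Rel i (i - 1) := by
  simp

/-- The tensor product over `k` of two complexes of `kG`-modules, with the diagonal action. -/
abbrev tens (C D : ChainComplex (Rep.{u} k G) ℤ) : ChainComplex (Rep.{u} k G) ℤ :=
  HomologicalComplex.tensorObj C D

/-- The inclusion of the summand `Cᵢ ⊗ Dⱼ` in degree `n = i + j` of the tensor product. -/
abbrev inc (C D : ChainComplex (Rep.{u} k G) ℤ) (i j n : ℤ) (h : i + j = n) :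
   C.X i ⊗ D.X j ⟶ (tens C D).X n := HomologicalComplex.ιTensorObj C D i j n h

variable {C D E : ChainComplex (Rep.{u} k G) ℤ}

lemma tens_hom_ext {n : ℤ} {A : Rep.{u} k G} {f g : (tens C D).X n ⟶ A}
    (h : ∀ i j (hij : i + j = n), inc C D i j n hij ≫ f = inc C D i j n hij ≫ g) : f = g :=
  HomologicalComplex.mapBifunctor.hom_ext h

/-- A morphism out of a degree of the tensor product, given on the summands. -/
def tensDesc {n : ℤ} {A : Rep.{u} k G} (f : ∀ i j, i + j = n → (C.X i ⊗ D.X j ⟶ A)) :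
    (tens C D).X n ⟶ A := HomologicalComplex.mapBifunctorDesc f

@[simp]
lemma inc_tensDesc {n : ℤ} {A : Rep.{u} k G} (f : ∀ i j, i + j = n → (C.X i ⊗ D.X j ⟶ A))
    (i j : ℤ) (h : i + j = n) : inc C D i j n h ≫ tensDesc f = f i j h :=
  HomologicalComplex.ι_mapBifunctorDesc (K₁ := C) (K₂ := D)
    (F := curriedTensor (Rep.{u} k G)) (c := ComplexShape.down ℤ) f i j h

@[simp]
lemma inc_tensDesc_assoc {n : ℤ} {A B : Rep.{u} k G}
    (f : ∀ i j, i + j = n → (C.X i ⊗ D.X j ⟶ A)) (i j : ℤ) (h : i + j = n) (g : A ⟶ B) :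
    inc C D i j n h ≫ tensDesc f ≫ g = f i j h ≫ g := by
  rw [← Category.assoc, inc_tensDesc]

lemma inc_d (i j n m: ℤ) (h : i + j = n) (hm : m + 1 = n) :
    inc C D i j n h ≫ (tens C D).d n m =
      (C.d i (i - 1) ▷ D.X j) ≫ inc C D (i - 1) j m (by lia) +
      i.negOnePow • ((C.X i ◁ D.d j (j - 1)) ≫ inc C D i (j - 1) m (by lia)) := by
  rw [HomologicalComplex.mapBifunctor.d_eq, Preadditive.comp_add,
    HomologicalComplex.mapBifunctor.ι_D₁, HomologicalComplex.mapBifunctor.ι_D₂,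
    HomologicalComplex.mapBifunctor.d₁_eq _ _ _ _ (down_rel i) j m (by change i - 1 + j = m; lia),
    HomologicalComplex.mapBifunctor.d₂_eq _ _ _ _ i (down_rel j) m (by change i + (j - 1) = m; lia)]
  congr 1
  exact one_smul _ _

lemma inc_map {C' D' : ChainComplex (Rep.{u} k G) ℤ} (f : C ⟶ C') (g : D ⟶ D') (i j n : ℤ)
    (h : i + j = n) :
    inc C D i j n h ≫ (HomologicalComplex.tensorHom f g).f n =
      (f.f i ⊗ₘ g.f j) ≫ inc C' D' i j n h := by
  rw [HomologicalComplex.ι_mapBifunctorMap, MonoidalCategory.tensorHom_def, Category.assoc]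
  rfl

/-- A chain map out of a tensor product, given on the summands. -/
def tensHom (f : ∀ i j n, i + j = n → (C.X i ⊗ D.X j ⟶ E.X n))
    (hf : ∀ i j n m (h : i + j = n) (hm : m + 1 = n), f i j n h ≫ E.d n m =
      (C.d i (i - 1) ▷ D.X j) ≫ f (i - 1) j m (by lia) +
      i.negOnePow • ((C.X i ◁ D.d j (j - 1)) ≫ f i (j - 1) m (by lia))) :
    tens C D ⟶ E where
  f n := tensDesc (fun i j h => f i j n h)
  comm' n m hnm := by
    refine tens_hom_ext fun i j h => ?_
    have hnm' : m + 1 = n := hnm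
    rw [inc_tensDesc_assoc, hf i j n m h hnm', ← Category.assoc, inc_d i j n m h hnm',
      Preadditive.add_comp, Category.assoc, Linear.units_smul_comp, Category.assoc,
      inc_tensDesc, inc_tensDesc]

/-- The symmetry of the tensor product, with the usual sign. -/
def tensComm (C D : ChainComplex (Rep.{u} k G) ℤ) : tens C D ⟶ tens D C :=
  tensHom (fun i j n h => (i * j).negOnePow • ((β_ (C.X i) (D.X j)).hom ≫ inc D C j i n (by lia))) (by
    intro i j n m h hm
    simp only [Linear.units_smul_comp, Category.assoc]
    rw [inc_d j i n m (by lia) hm]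
    simp only [Preadditive.comp_add, smul_add, Linear.comp_units_smul, smul_smul]
    rw [add_comm]
    congr 1
    · rw [BraidedCategory.braiding_naturality_left_assoc]
      congr 1
      rw [← Int.negOnePow_add, Int.negOnePow_eq_iff]
      exact ⟨j, by ring⟩
    · rw [BraidedCategory.braiding_naturality_right_assoc, ← Int.negOnePow_add]
      congr 1
      rw [show i + i * (j-1) = i * j by ring])

lemma tensComm_comp : tensComm C D ≫ tensComm D C = 𝟙 _ := by
  ext n : 1
  refine tens_hom_ext fun i j h => ?_
  simp [tensComm, tensHom, Linear.units_smul_comp, Linear.comp_units_smul, smul_smul, mul_comm]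

/-- The tensor product of complexes is commutative up to isomorphism. -/
def tensCommIso (C D : ChainComplex (Rep.{u} k G) ℤ) : tens C D ≅ tens D C where
  hom := tensComm C D
  inv := tensComm D C
  hom_inv_id := tensComm_comp
  inv_hom_id := tensComm_comp

lemma tensorHom_comp {C C' C'' D D' D'' : ChainComplex (Rep.{u} k G) ℤ} (f : C ⟶ C') (f' : C' ⟶ C'')
    (g : D ⟶ D') (g' : D' ⟶ D'') :
    HomologicalComplex.tensorHom f g ≫ HomologicalComplex.tensorHom f' g' =
      HomologicalComplex.tensorHom (f ≫ f') (g ≫ g') :=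
  tensorHom_comp_tensorHom f g f' g'

lemma tensorHom_one : HomologicalComplex.tensorHom (𝟙 C) (𝟙 D) = 𝟙 _ :=
  id_tensorHom_id C D

/-- The tensor product of two homotopies. -/
def tensHomotopy {C' D' : ChainComplex (Rep.{u} k G) ℤ} {f f' : C ⟶ C'} {g g' : D ⟶ D'}
    (hf : Homotopy f f') (hg : Homotopy g g') :
    Homotopy (HomologicalComplex.tensorHom f g) (HomologicalComplex.tensorHom f' g') :=
  (HomologicalComplex.mapBifunctorMapHomotopy₁ hf g _ _).trans
    (HomologicalComplex.mapBifunctorMapHomotopy₂ f' hg _ _)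

/-- The tensor product of two homotopy equivalences. -/
def tensEquiv {C' D' : ChainComplex (Rep.{u} k G) ℤ} (f : HomotopyEquiv C C')
    (g : HomotopyEquiv D D') : HomotopyEquiv (tens C D) (tens C' D') where
  hom := HomologicalComplex.tensorHom f.hom g.hom
  inv := HomologicalComplex.tensorHom f.inv g.inv
  homotopyHomInvId := (Homotopy.ofEq (tensorHom_comp ..)).trans
    ((tensHomotopy f.homotopyHomInvId g.homotopyHomInvId).trans (Homotopy.ofEq tensorHom_one))
  homotopyInvHomId := (Homotopy.ofEq (tensorHom_comp ..)).trans
    ((tensHomotopy f.homotopyInvHomId g.homotopyInvHomId).trans (Homotopy.ofEq tensorHom_one))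

/-! ## Bounded complexes -/

/-- A complex is bounded if it vanishes in all but finitely many degrees. -/
def IsBounded (C : ChainComplex (Rep.{u} k G) ℤ) : Prop := ∃ N : ℤ, ∀ n, N < |n| → IsZero (C.X n)

open Classical in
/-- The projection of a degree of the tensor product onto a summand. -/
def proj (C D : ChainComplex (Rep.{u} k G) ℤ) (i j n : ℤ) (h : i + j = n) :
    (tens C D).X n ⟶ C.X i ⊗ D.X j :=
  tensDesc (fun i' j' h' => if hi : i' = i then eqToHom (by
    obtain rfl : i' = i := hi
    obtain rfl : j' = j := by lia
    rfl) else 0)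

@[simp]
lemma inc_proj (i j n : ℤ) (h : i + j = n) : inc C D i j n h ≫ proj C D i j n h = 𝟙 _ := by
  simp [proj]

@[simp]
lemma inc_proj_assoc (i j n : ℤ) (h : i + j = n) {A : Rep.{u} k G} (g : C.X i ⊗ D.X j ⟶ A) :
    inc C D i j n h ≫ proj C D i j n h ≫ g = g := by
  rw [← Category.assoc, inc_proj, Category.id_comp]

lemma inc_proj_ne (i j i' j' n : ℤ) (h : i + j = n) (h' : i' + j' = n) (hi : i ≠ i') :
    inc C D i j n h ≫ proj C D i' j' n h' = 0 := by
  simp [proj, hi]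

lemma proj_inc_sum {N : ℤ} (hN : ∀ n, N < |n| → IsZero (C.X n)) (n : ℤ) :
    ∑ i ∈ Finset.Icc (-N) N, proj C D i (n - i) n (by lia) ≫ inc C D i (n - i) n (by lia) = 𝟙 _ := by
  refine tens_hom_ext fun i j h => ?_
  obtain rfl : j = n - i := by lia
  rw [Preadditive.comp_sum, Category.comp_id]
  by_cases hi : i ∈ Finset.Icc (-N) N
  · rw [Finset.sum_eq_single i, inc_proj_assoc]
    · intro b _ hb
      rw [← Category.assoc, inc_proj_ne _ _ _ _ _ _ _ hb.symm, zero_comp]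
    · exact fun h' => absurd hi h'
  · have hz : IsZero (C.X i ⊗ D.X (n - i)) :=
      Functor.map_isZero (tensorRight (D.X (n - i))) (hN i (by
        by_contra hc
        exact hi (by rw [Finset.mem_Icc]; exact abs_le.1 (not_lt.1 hc))))
    exact hz.eq_of_src _ _

lemma isIso_tensDesc {N : ℤ} (hN : ∀ n, N < |n| → IsZero (C.X n)) {n : ℤ} {A : Rep.{u} k G}
    (f : ∀ i j, i + j = n → (C.X i ⊗ D.X j ⟶ A)) (p : ∀ i j, i + j = n → (A ⟶ C.X i ⊗ D.X j))
    (h₁ : ∀ i j h, f i j h ≫ p i j h = 𝟙 _)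
    (h₂ : ∀ i j i' j' h h', i ≠ i' → f i j h ≫ p i' j' h' = 0)
    (h₃ : ∑ i ∈ Finset.Icc (-N) N, p i (n - i) (by lia) ≫ f i (n - i) (by lia) = 𝟙 _) :
    IsIso (tensDesc f) := by
  refine ⟨∑ i ∈ Finset.Icc (-N) N, p i (n - i) (by lia) ≫ inc C D i (n - i) n (by lia), ?_, ?_⟩
  · rw [← proj_inc_sum (D := D) hN, Preadditive.comp_sum]
    refine Finset.sum_congr rfl fun i _ => ?_
    rw [← Category.assoc]
    congr 1
    refine tens_hom_ext fun i' j' h' => ?_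
    rw [inc_tensDesc_assoc]
    by_cases hi : i' = i
    · subst hi
      obtain rfl : j' = n - i' := by lia
      rw [h₁, inc_proj]
    · rw [h₂ _ _ _ _ _ _ hi, inc_proj_ne _ _ _ _ _ _ _ hi]
  · rw [Preadditive.sum_comp, ← h₃]
    refine Finset.sum_congr rfl fun i _ => ?_
    rw [Category.assoc, inc_tensDesc]

lemma d_proj (i j n m a b : ℤ) (h : i + j = m) (hm : m + 1 = n) (ha : i + 1 = a) (hb : j + 1 = b) :
    (tens C D).d n m ≫ proj C D i j m h = proj C D a j n (by lia) ≫ (C.d a i ▷ D.X j) +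
      i.negOnePow • (proj C D i b n (by lia) ≫ (C.X i ◁ D.d b j)) := by
  refine tens_hom_ext fun i' j' h' => ?_
  rw [← Category.assoc, inc_d i' j' n m h' hm, Preadditive.add_comp, Preadditive.comp_add,
    Linear.units_smul_comp, Linear.comp_units_smul, Category.assoc, Category.assoc]
  by_cases h1 : i' = a
  · subst h1
    obtain rfl : j' = j := by lia
    obtain rfl : i = i' - 1 := by lia
    rw [inc_proj, inc_proj_assoc, inc_proj_ne _ _ _ _ _ _ _ (by lia), comp_zero, smul_zero,
      ← Category.assoc (inc C D i' j' n h'), inc_proj_ne _ _ _ _ _ _ _ (by lia), zero_comp,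
      smul_zero, Category.comp_id]
  · rw [inc_proj_ne (i' - 1) _ _ _ _ _ _ (by lia), comp_zero,
      ← Category.assoc (inc C D i' j' n h'), inc_proj_ne _ _ a _ _ _ _ (by lia), zero_comp,
      zero_add, zero_add]
    by_cases h2 : i' = i
    · subst h2
      obtain rfl : j' = b := by lia
      obtain rfl : j = j' - 1 := by lia
      rw [inc_proj, inc_proj_assoc, Category.comp_id]
    · rw [inc_proj_ne _ _ _ _ _ _ _ h2, ← Category.assoc (inc C D i' j' n h'),
        inc_proj_ne _ _ _ _ _ _ _ h2, comp_zero, zero_comp, smul_zero, smul_zero]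

/-! ## Dual complexes -/

/-- The `k`-linear dual of a `kG`-module, with the action `(g φ) m = φ (g⁻¹ m)`. -/
abbrev dualRep (M : Rep.{u} k G) : Rep.{u} k G := Rep.of M.ρ.dual

/-- The transpose of a homomorphism. -/
def dualMap {M N : Rep.{u} k G} (f : M ⟶ N) : dualRep N ⟶ dualRep M :=
  Rep.ofHom ⟨f.hom.toLinearMap.dualMap, fun g => by
    ext φ m
    change φ (N.ρ g⁻¹ (f.hom m)) = φ (f.hom (M.ρ g⁻¹ m))
    rw [Rep.hom_comm_apply]⟩

lemma dualMap_apply {M N : Rep.{u} k G} (f : M ⟶ N) (φ : Module.Dual k N) (m : M) :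
    (show Module.Dual k M from (dualMap f).hom φ) m = φ (f.hom m) := rfl

lemma dual_ext {M N : Rep.{u} k G} {f g : M ⟶ dualRep N}
    (h : ∀ (m : M) (x : N), (show Module.Dual k N from f.hom m) x =
      (show Module.Dual k N from g.hom m) x) :
    f = g := by
  refine Rep.hom_ext (Representation.IntertwiningMap.ext (LinearMap.ext fun m => ?_))
  exact LinearMap.ext (h m)

@[simp]
lemma dualMap_id (M : Rep.{u} k G) : dualMap (𝟙 M) = 𝟙 _ := rfl

lemma dualMap_comp {M N L : Rep.{u} k G} (f : M ⟶ N) (g : N ⟶ L) :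
    dualMap (f ≫ g) = dualMap g ≫ dualMap f := rfl

lemma dualMap_zero (M N : Rep.{u} k G) : dualMap (0 : M ⟶ N) = 0 :=
  dual_ext fun φ _ => map_zero (φ : Module.Dual k N)

lemma dualMap_add {M N : Rep.{u} k G} (f g : M ⟶ N) : dualMap (f + g) = dualMap f + dualMap g :=
  dual_ext fun φ _ => map_add (φ : Module.Dual k N) _ _

lemma dualMap_sum {M N : Rep.{u} k G} {ι : Type*} (s : Finset ι) (f : ι → (M ⟶ N)) :
    dualMap (∑ i ∈ s, f i) = ∑ i ∈ s, dualMap (f i) :=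
  map_sum (AddMonoidHom.mk' (dualMap (M := M) (N := N)) dualMap_add) f s

lemma dualMap_neg {M N : Rep.{u} k G} (f : M ⟶ N) : dualMap (-f) = - dualMap f :=
  map_neg (AddMonoidHom.mk' (dualMap (M := M) (N := N)) dualMap_add) f

lemma dualMap_units_smul {M N : Rep.{u} k G} (e : ℤˣ) (f : M ⟶ N) :
    dualMap (e • f) = e • dualMap f := by
  rcases Int.units_eq_one_or e with rfl | rfl
  · simp
  · simp [dualMap_neg]

/-- The dual complex: its degree `n` part is the dual of the degree `-n` part of `C`, and its
differential in degree `n` is `(-1) ^ (n + 1)` times the transpose of a differential of `C`. -/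
abbrev dualComplex (C : ChainComplex (Rep.{u} k G) ℤ) : ChainComplex (Rep.{u} k G) ℤ where
  X n := dualRep (C.X (-n))
  d n m := (n + 1).negOnePow • dualMap (C.d (-m) (-n))
  shape n m h := by
    rw [C.shape, dualMap_zero, smul_zero]
    intro h'
    have h'' : -n + 1 = -m := h'
    exact h (show m + 1 = n by lia)
  d_comp_d' n m l _ _ := by
    rw [Linear.units_smul_comp, Linear.comp_units_smul, ← dualMap_comp, C.d_comp_d, dualMap_zero,
      smul_zero, smul_zero]

/-- The dual of a chain map. -/
def dualComplexMap (f : C ⟶ D) : dualComplex D ⟶ dualComplex C where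
  f n := dualMap (f.f (-n))
  comm' n m h := by
    change _ ≫ ((n + 1).negOnePow • dualMap (C.d (-m) (-n))) =
      ((n + 1).negOnePow • dualMap (D.d (-m) (-n))) ≫ _
    rw [Linear.units_smul_comp, Linear.comp_units_smul, ← dualMap_comp, ← dualMap_comp, f.comm]

/-- The dual of a homotopy. -/
def dualHomotopy {f g : C ⟶ D} (h : Homotopy f g) :
    Homotopy (dualComplexMap f) (dualComplexMap g) where
  hom i j := i.negOnePow • dualMap (h.hom (-j) (-i))
  zero i j hij := by
    have h0 : h.hom (-j) (-i) = 0 := by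
      refine h.zero _ _ fun h' => ?_
      have h'' : -j + 1 = -i := h'
      exact hij (show i + 1 = j by lia)
    rw [h0, dualMap_zero, smul_zero]
  comm i := by
    have e := h.comm (-i)
    rw [dNext_eq h.hom (show (ComplexShape.down ℤ).Rel (-i) (-(i+1)) by simp),
      prevD_eq h.hom (show (ComplexShape.down ℤ).Rel (-(i-1)) (-i) by change _ = _; ring)] at e
    rw [dNext_eq _ (show (ComplexShape.down ℤ).Rel i (i-1) by simp),
      prevD_eq _ (show (ComplexShape.down ℤ).Rel (i+1) i by simp)]
    change dualMap (f.f (-i)) = (((i + 1).negOnePow • dualMap (D.d (-(i-1)) (-i))) ≫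
      ((i-1).negOnePow • dualMap (h.hom (-i) (-(i-1)))) +
        (i.negOnePow • dualMap (h.hom (-(i+1)) (-i))) ≫
      ((i + 1 + 1).negOnePow • dualMap (C.d (-i) (-(i+1))))) + dualMap (g.f (-i))
    rw [e, dualMap_add, dualMap_add, dualMap_comp, dualMap_comp, Linear.units_smul_comp,
      Linear.comp_units_smul, Linear.units_smul_comp, Linear.comp_units_smul, smul_smul, smul_smul,
      ← Int.negOnePow_add, ← Int.negOnePow_add, Int.negOnePow_even _ ⟨i, by ring⟩,
      Int.negOnePow_even _ ⟨i + 1, by ring⟩, one_smul, one_smul,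
      add_comm (dualMap _ ≫ dualMap _)]

/-- The dual of a homotopy equivalence. -/
def dualEquiv (f : HomotopyEquiv C D) : HomotopyEquiv (dualComplex C) (dualComplex D) where
  hom := dualComplexMap f.inv
  inv := dualComplexMap f.hom
  homotopyHomInvId := dualHomotopy f.homotopyHomInvId
  homotopyInvHomId := dualHomotopy f.homotopyInvHomId

/-! ## The dual of a tensor product -/

/-- The canonical map from the tensor product of the duals. -/
def dualDistrib (M N : Rep.{u} k G) : dualRep M ⊗ dualRep N ⟶ dualRep (M ⊗ N) :=
  Rep.ofHom ⟨TensorProduct.dualDistrib k M N, fun g => by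
    refine TensorProduct.ext' fun φ ψ => ?_
    refine TensorProduct.ext' fun x y => ?_
    rfl⟩

lemma dualDistrib_apply {M N : Rep.{u} k G} (φ : Module.Dual k M) (ψ : Module.Dual k N)
   (x : M) (y : N) : (show Module.Dual k (TensorProduct k M N) from
      (dualDistrib M N).hom (φ ⊗ₜ[k] ψ)) (x ⊗ₜ[k] y) = φ x * ψ y := rfl

lemma hom_ext_tensor {M N L : Rep.{u} k G} {f g : M ⊗ N ⟶ L}
    (h : ∀ (x : M) (y : N), f.hom (x ⊗ₜ[k] y) = g.hom (x ⊗ₜ[k] y)) : f = g := by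
  ext1
  apply Representation.IntertwiningMap.ext
  exact TensorProduct.ext' h

lemma dualDistrib_nat_left {M M' N : Rep.{u} k G} (f : M ⟶ M') :
    (dualMap f ▷ dualRep N) ≫ dualDistrib M N = dualDistrib M' N ≫ dualMap (f ▷ N) := by
  refine hom_ext_tensor fun x y => ?_
  refine TensorProduct.ext' fun x' y' => ?_
  rfl

lemma dualDistrib_nat_right {M N N' : Rep.{u} k G} (f : N ⟶ N') :
    (dualRep M ◁ dualMap f) ≫ dualDistrib M N = dualDistrib M N' ≫ dualMap (M ◁ f) := by
  refine hom_ext_tensor fun x y => ?_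
  refine TensorProduct.ext' fun x' y' => ?_
  rfl

lemma isIso_of_bijective {M N : Rep.{u} k G} (f : M ⟶ N) (h : Function.Bijective f.hom) :
    IsIso f := by
  let e : M.ρ.Equiv N.ρ := { f.hom, Equiv.ofBijective _ h with }
  exact (Rep.mkIso e).isIso_hom

lemma isIso_dualDistrib (M N : Rep.{u} k G) [Module.Finite k M] [Module.Finite k N] :
    IsIso (dualDistrib M N) :=
  isIso_of_bijective _ (TensorProduct.dualDistribEquiv k M N).bijective

lemma units_smul_whiskerRight {X Y : Rep.{u} k G} (e : ℤˣ) (f : X ⟶ Y) (Z : Rep.{u} k G) :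
    (e • f) ▷ Z = e • (f ▷ Z) := by
  rcases Int.units_eq_one_or e with rfl | rfl
  · simp
  · rw [Units.neg_smul, Units.neg_smul, one_smul, one_smul]
    exact (tensorRight Z).map_neg

lemma whiskerLeft_units_smul {X Y : Rep.{u} k G} (e : ℤˣ) (f : X ⟶ Y) (Z : Rep.{u} k G) :
    Z ◁ (e • f) = e • (Z ◁ f) := by
  rcases Int.units_eq_one_or e with rfl | rfl
  · simp
  · rw [Units.neg_smul, Units.neg_smul, one_smul, one_smul]
    exact (tensorLeft Z).map_neg

lemma proj_inc_congr (i j j' n : ℤ) (h : i + j = n) (h' : i + j' = n) :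
    proj C D i j n h ≫ inc C D i j n h = proj C D i j' n h' ≫ inc C D i j' n h' := by
  obtain rfl : j = j' := by lia
  rfl

/-- The components of `dualTens`. -/
def dualTensComp (C D : ChainComplex (Rep.{u} k G) ℤ) (i j n : ℤ) (h : i + j = n) :
    dualRep (C.X (-i)) ⊗ dualRep (D.X (-j)) ⟶ dualRep ((tens C D).X (-n)) :=
  (i * j).negOnePow • (dualDistrib (C.X (-i)) (D.X (-j)) ≫
    dualMap (proj C D (-i) (-j) (-n) (by lia)))

lemma dualTensComp_comm (i j n m : ℤ) (h : i + j = n) (hm : m + 1 = n) :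
    dualTensComp C D i j n h ≫ (dualComplex (tens C D)).d n m =
      ((dualComplex C).d i (i - 1) ▷ dualRep (D.X (-j))) ≫
        dualTensComp C D (i - 1) j m (by lia) +
      i.negOnePow • ((dualRep (C.X (-i)) ◁ (dualComplex D).d j (j - 1)) ≫
        dualTensComp C D i (j - 1) m (by lia)) := by
  rw [dualTensComp, Linear.units_smul_comp, Linear.comp_units_smul, Category.assoc, ← dualMap_comp,
    d_proj (-i) (-j) (-m) (-n) (-(i-1)) (-(j-1)) (by lia) (by lia) (by lia) (by lia),
    dualMap_add, dualMap_units_smul, dualMap_comp, dualMap_comp, units_smul_whiskerRight,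
    whiskerLeft_units_smul, dualTensComp, dualTensComp]
  simp only [Linear.units_smul_comp, Linear.comp_units_smul, Preadditive.comp_add, smul_add,
    smul_smul, ← Int.negOnePow_add]
  congr 1
  · rw [← Category.assoc, ← dualDistrib_nat_left, Category.assoc]
    congr 1
    rw [Int.negOnePow_eq_iff]
    exact ⟨j, by subst h; ring⟩
  · rw [← Category.assoc, ← dualDistrib_nat_right, Category.assoc]
    congr 1
    rw [Int.negOnePow_eq_iff]
    exact ⟨0, by subst h; ring⟩

/-- The canonical chain map `C* ⊗ D* ⟶ (C ⊗ D)*`. -/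
def dualTens (C D : ChainComplex (Rep.{u} k G) ℤ) :
    tens (dualComplex C) (dualComplex D) ⟶ dualComplex (tens C D) :=
  tensHom (C := dualComplex C) (D := dualComplex D) (dualTensComp C D) dualTensComp_comm

/-- A complex whose terms are finitely generated. -/
def IsFinite (C : ChainComplex (Rep.{u} k G) ℤ) : Prop := ∀ n, Module.Finite k (C.X n)

lemma isZero_dualRep {M : Rep.{u} k G} (h : IsZero M) : IsZero (dualRep M) := by
  rw [Rep.isZero_iff] at *
  exact (inferInstance : Subsingleton (Module.Dual k M))

lemma isIso_dualTens (hC : IsBounded C) (fC : IsFinite C) (fD : IsFinite D) :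
    IsIso (dualTens C D) := by
  obtain ⟨N, hN⟩ := hC
  have hN' : ∀ n, N < |n| → IsZero ((dualComplex C).X n) := fun n hn =>
    isZero_dualRep (hN (-n) (by rwa [abs_neg]))
  have hI : ∀ i j, IsIso (dualDistrib (C.X i) (D.X j)) := fun i j => by
    have := fC i
    have := fD j
    exact isIso_dualDistrib _ _
  let q (i j n : ℤ) (h : i + j = n) :
      dualRep ((tens C D).X (-n)) ⟶ dualRep (C.X (-i)) ⊗ dualRep (D.X (-j)) :=
    (i * j).negOnePow •
      (dualMap (inc C D (-i) (-j) (-n) (by lia)) ≫ inv (dualDistrib (C.X (-i)) (D.X (-j))))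
  have h₁ : ∀ i j n h, dualTensComp C D i j n h ≫ q i j n h = 𝟙 _ := by
    intro i j n h
    simp only [q, dualTensComp]
    rw [Linear.units_smul_comp, Linear.comp_units_smul, smul_smul, Int.units_mul_self, one_smul,
      Category.assoc, ← Category.assoc (dualMap _), ← dualMap_comp, inc_proj, dualMap_id,
      Category.id_comp, IsIso.hom_inv_id]
  have h₂ : ∀ n i j i' j' h h', i ≠ i' → dualTensComp C D i j n h ≫ q i' j' n h' = 0 := by
    intro n i j i' j' h h' hi
    simp only [q, dualTensComp]
    rw [Linear.units_smul_comp, Linear.comp_units_smul,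
      Category.assoc, ← Category.assoc (dualMap _), ← dualMap_comp,
      inc_proj_ne _ _ _ _ _ _ _ (by lia), dualMap_zero, zero_comp, comp_zero, smul_zero, smul_zero]
  have h₃ : ∀ n, ∑ i ∈ Finset.Icc (-N) N, q i (n - i) n (by lia) ≫
      dualTensComp C D i (n - i) n (by lia) = 𝟙 _ := by
    intro n
    rw [← dualMap_id, ← proj_inc_sum hN, dualMap_sum]
    refine Finset.sum_equiv (Equiv.neg ℤ) ?_ ?_
    · intro i
      simp only [Finset.mem_Icc, Equiv.neg_apply]
      constructor <;> intro h <;> constructor <;> linarith [h.1, h.2]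
    · intro i _
      simp only [q, dualTensComp, Equiv.neg_apply]
      rw [Linear.units_smul_comp, Linear.comp_units_smul, smul_smul, Int.units_mul_self, one_smul,
        Category.assoc, IsIso.inv_hom_id_assoc, ← dualMap_comp]
      congr 1
      exact proj_inc_congr _ _ _ _ _ _
  have : ∀ n, IsIso ((dualTens C D).f n) := fun n =>
    isIso_tensDesc (C := dualComplex C) (D := dualComplex D) hN'
      (fun i j h => dualTensComp C D i j n h) (fun i j h => q i j n h) (fun i j h => h₁ i j n h)
      (fun i j i' j' h h' => h₂ n i j i' j' h h') (h₃ n)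
  exact HomologicalComplex.Hom.isIso_of_components _

/-! ## Additive functors compatible with tensor products and duals

Auxiliary material, used below to see that restriction along group homomorphisms and the Brauer
construction induce homomorphisms on the group of endotrivial complexes. -/

section functor

universe w
variable {H : Type w} [Group H]

lemma map_units_smul (F : Rep.{u} k G ⥤ Rep.{u} k H) [F.Additive] {M N : Rep.{u} k G} (e : ℤˣ)
    (f : M ⟶ N) : F.map (e • f) = e • F.map f := by
  rcases Int.units_eq_one_or e with rfl | rfl
  · rw [one_smul, one_smul]
  · rw [Units.neg_smul, Units.neg_smul, one_smul, one_smul, F.map_neg]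

/-- A natural map `F M ⊗ F N ⟶ F (M ⊗ N)`. -/
structure TensorData (F : Rep.{u} k G ⥤ Rep.{u} k H) where
  μ (M N : Rep.{u} k G) : F.obj M ⊗ F.obj N ⟶ F.obj (M ⊗ N)
  μ_left {M M' : Rep.{u} k G} (f : M ⟶ M') (N : Rep.{u} k G) :
    (F.map f ▷ F.obj N) ≫ μ M' N = μ M N ≫ F.map (f ▷ N)
  μ_right (M : Rep.{u} k G) {N N' : Rep.{u} k G} (f : N ⟶ N') :
    (F.obj M ◁ F.map f) ≫ μ M N' = μ M N ≫ F.map (M ◁ f)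

/-- Apply an additive functor to a complex, degree by degree. -/
abbrev mapC (F : Rep.{u} k G ⥤ Rep.{u} k H) [F.Additive] (C : ChainComplex (Rep.{u} k G) ℤ) :
    ChainComplex (Rep.{u} k H) ℤ :=
  (F.mapHomologicalComplex (ComplexShape.down ℤ)).obj C

variable {F : Rep.{u} k G ⥤ Rep.{u} k H} [F.Additive]

/-- The components of `mapTens`. -/
def mapTensComp (T : TensorData F) (C D : ChainComplex (Rep.{u} k G) ℤ) (i j n : ℤ)
    (h : i + j = n) : F.obj (C.X i) ⊗ F.obj (D.X j) ⟶ F.obj ((tens C D).X n) :=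
  T.μ (C.X i) (D.X j) ≫ F.map (inc C D i j n h)

lemma mapTensComp_comm (T : TensorData F) (i j n m : ℤ) (h : i + j = n) (hm : m + 1 = n) :
    mapTensComp T C D i j n h ≫ F.map ((tens C D).d n m) =
      (F.map (C.d i (i - 1)) ▷ F.obj (D.X j)) ≫ mapTensComp T C D (i - 1) j m (by lia) +
      i.negOnePow • ((F.obj (C.X i) ◁ F.map (D.d j (j - 1))) ≫
        mapTensComp T C D i (j - 1) m (by lia)) := by
  simp only [mapTensComp]
  rw [Category.assoc, ← F.map_comp, inc_d i j n m h hm, F.map_add, map_units_smul, F.map_comp,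
    F.map_comp, Preadditive.comp_add, Linear.comp_units_smul, ← Category.assoc (_ ▷ _), T.μ_left,
    ← Category.assoc (_ ◁ _), T.μ_right, Category.assoc, Category.assoc]

/-- The natural chain map `F C ⊗ F D ⟶ F (C ⊗ D)`. -/
def mapTens (T : TensorData F) (C D : ChainComplex (Rep.{u} k G) ℤ) :
    tens (mapC F C) (mapC F D) ⟶ mapC F (tens C D) :=
  tensHom (C := mapC F C) (D := mapC F D) (E := mapC F (tens C D)) (mapTensComp T C D)
    (mapTensComp_comm T)

lemma isIso_mapTens (T : TensorData F) (hC : IsBounded C)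
    (hI : ∀ i j, IsIso (T.μ (C.X i) (D.X j))) : IsIso (mapTens T C D) := by
  obtain ⟨N, hN⟩ := hC
  have hN' : ∀ n, N < |n| → IsZero ((mapC F C).X n) := fun n hn =>
    F.map_isZero (hN n hn)
  let q (i j n : ℤ) (h : i + j = n) :
      F.obj ((tens C D).X n) ⟶ F.obj (C.X i) ⊗ F.obj (D.X j) :=
    F.map (proj C D i j n h) ≫ inv (T.μ (C.X i) (D.X j))
  have h₁ : ∀ i j n h, mapTensComp T C D i j n h ≫ q i j n h = 𝟙 _ := by
    intro i j n h
    simp only [q, mapTensComp]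
    rw [Category.assoc, ← Category.assoc (F.map _), ← F.map_comp, inc_proj, F.map_id,
      Category.id_comp, IsIso.hom_inv_id]
  have h₂ : ∀ n i j i' j' h h', i ≠ i' → mapTensComp T C D i j n h ≫ q i' j' n h' = 0 := by
    intro n i j i' j' h h' hi
    simp only [q, mapTensComp]
    rw [Category.assoc, ← Category.assoc (F.map _), ← F.map_comp, inc_proj_ne _ _ _ _ _ _ _ hi,
      F.map_zero, zero_comp, comp_zero]
  have h₃ : ∀ n, ∑ i ∈ Finset.Icc (-N) N, q i (n - i) n (by lia) ≫
      mapTensComp T C D i (n - i) n (by lia) = 𝟙 _ := by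
    intro n
    rw [← F.map_id, ← proj_inc_sum hN, F.map_sum]
    refine Finset.sum_congr rfl fun i _ => ?_
    simp only [q, mapTensComp]
    rw [Category.assoc, IsIso.inv_hom_id_assoc, ← F.map_comp]
  have : ∀ n, IsIso ((mapTens T C D).f n) := fun n =>
    isIso_tensDesc (C := mapC F C) (D := mapC F D) hN'
      (fun i j h => mapTensComp T C D i j n h) (fun i j h => q i j n h) (fun i j h => h₁ i j n h)
      (fun i j i' j' h h' => h₂ n i j i' j' h h') (h₃ n)
  exact HomologicalComplex.Hom.isIso_of_components _

/-- A natural map `F (M*) ⟶ (F M)*`. -/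
structure DualData (F : Rep.{u} k G ⥤ Rep.{u} k H) where
  ν (M : Rep.{u} k G) : F.obj (dualRep M) ⟶ dualRep (F.obj M)
  ν_nat {M N : Rep.{u} k G} (f : M ⟶ N) :
    F.map (dualMap f) ≫ ν M = ν N ≫ dualMap (F.map f)

lemma dualData_comm (T : DualData F) (n m : ℤ) :
    T.ν (C.X (-n)) ≫ (dualComplex (mapC F C)).d n m =
      F.map ((dualComplex C).d n m) ≫ T.ν (C.X (-m)) := by
  change T.ν (C.X (-n)) ≫ ((n + 1).negOnePow • dualMap (F.map (C.d (-m) (-n)))) =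
    F.map ((n + 1).negOnePow • dualMap (C.d (-m) (-n))) ≫ T.ν (C.X (-m))
  rw [map_units_smul, Linear.units_smul_comp, Linear.comp_units_smul, T.ν_nat]

/-- The natural chain map `F (C*) ⟶ (F C)*`. -/
def mapDual (T : DualData F) (C : ChainComplex (Rep.{u} k G) ℤ) :
    mapC F (dualComplex C) ⟶ dualComplex (mapC F C) where
  f n := T.ν (C.X (-n))
  comm' n m _ := dualData_comm T n m

lemma isIso_mapDual (T : DualData F) (hI : ∀ i, IsIso (T.ν (C.X i))) : IsIso (mapDual T C) := by
  have : ∀ n, IsIso ((mapDual T C).f n) := fun n => hI (-n)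
  exact HomologicalComplex.Hom.isIso_of_components _

/-- The complex `k[0]`: the trivial module `k` in degree `0`, and zero elsewhere. -/
abbrev unitComplex (k : Type u) [Field k] (G : Type v) [Group G] : ChainComplex (Rep.{u} k G) ℤ :=
  (HomologicalComplex.single (Rep.{u} k G) (ComplexShape.down ℤ) 0).obj (𝟙_ (Rep.{u} k G))

/-- If `F` preserves the trivial module, then it preserves `k[0]`. -/
def mapUnit (e : F.obj (𝟙_ _) ≅ 𝟙_ _) : mapC F (unitComplex k G) ≅ unitComplex k H :=
  (HomologicalComplex.singleMapHomologicalComplex F (ComplexShape.down ℤ) 0).app _ ≪≫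
    (HomologicalComplex.single (Rep.{u} k H) (ComplexShape.down ℤ) 0).mapIso e

end functor

/-- The trivial module is self-dual. -/
def dualUnitRep : dualRep (𝟙_ (Rep.{u} k G)) ≅ 𝟙_ (Rep.{u} k G) where
  hom := Rep.ofHom ⟨(LinearMap.ringLmapEquivSelf k k k).toLinearMap, fun g => by ext; rfl⟩
  inv := Rep.ofHom ⟨(LinearMap.ringLmapEquivSelf k k k).symm.toLinearMap, fun g => by
    ext; rfl⟩
  hom_inv_id := by
    refine Rep.hom_ext (Representation.IntertwiningMap.ext (LinearMap.ext fun x => ?_))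
    exact (LinearMap.ringLmapEquivSelf k k k).symm_apply_apply x
  inv_hom_id := by
    refine Rep.hom_ext (Representation.IntertwiningMap.ext (LinearMap.ext fun x => ?_))
    exact (LinearMap.ringLmapEquivSelf k k k).apply_symm_apply x

lemma isZero_unitComplex {n : ℤ} (hn : n ≠ 0) : IsZero ((unitComplex k G).X n) :=
  HomologicalComplex.isZero_single_obj_X _ _ _ _ hn

/-- The degree `0` part of the dual of `k[0]`. -/
def dualUnitAux : dualRep ((unitComplex k G).X (-0)) ≅ 𝟙_ (Rep.{u} k G) where
  hom := dualMap (HomologicalComplex.singleObjXIsoOfEq _ 0 _ (-0) (by simp)).inv ≫ dualUnitRep.hom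
  inv := dualUnitRep.inv ≫ dualMap (HomologicalComplex.singleObjXIsoOfEq _ 0 _ (-0) (by simp)).hom
  hom_inv_id := by
    rw [Category.assoc, Iso.hom_inv_id_assoc, ← dualMap_comp, Iso.hom_inv_id, dualMap_id]
  inv_hom_id := by
    rw [Category.assoc, ← Category.assoc (dualMap _), ← dualMap_comp, Iso.inv_hom_id, dualMap_id,
      Category.id_comp, Iso.inv_hom_id]

/-- The complex `k[0]` is self-dual. -/
def dualUnitHom : dualComplex (unitComplex k G) ⟶ unitComplex k G :=
  HomologicalComplex.mkHomToSingle (K := dualComplex (unitComplex k G)) dualUnitAux.hom (by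
    intro i hi
    have hi' : i ≠ 0 := by
      have : (0 : ℤ) + 1 = i := hi
      lia
    exact (isZero_dualRep (isZero_unitComplex (by lia))).eq_of_src _ _)

lemma isIso_dualUnitHom : IsIso (dualUnitHom (k := k) (G := G)) := by
  have : ∀ n, IsIso ((dualUnitHom (k := k) (G := G)).f n) := by
    intro n
    by_cases hn : n = 0
    · subst hn
      have : (dualUnitHom (k := k) (G := G)).f 0 = dualUnitAux.hom ≫
          (HomologicalComplex.singleObjXSelf (ComplexShape.down ℤ) 0 (𝟙_ (Rep.{u} k G))).inv :=
        HomologicalComplex.mkHomToSingle_f ..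
      rw [this]
      infer_instance
    · have h1 : IsZero ((unitComplex k G).X n) := isZero_unitComplex hn
      have h2 : IsZero (dualRep ((unitComplex k G).X (-n))) :=
        isZero_dualRep (isZero_unitComplex (by lia))
      exact ⟨0, h2.eq_of_src _ _, h1.eq_of_src _ _⟩
  exact HomologicalComplex.Hom.isIso_of_components _

/-! ## p-permutation modules -/

/-- A permutation module: a representation having a basis that is permuted by the group. -/
def IsPermutation {H : Type v} [Group H] {V : Type u} [AddCommGroup V] [Module k V]
    (ρ : Representation k H V) : Prop :=
  ∃ (X : Type u) (_ : MulAction H X) (b : Module.Basis X k V), ∀ (h : H) (x : X), ρ h (b x) = b (h • x)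

/-- A `p`-permutation module: its restriction to every `p`-subgroup `P` of `G` is a permutation
module for `P`. -/
def IsPPermutation (p : ℕ) (M : Rep.{u} k G) : Prop :=
  ∀ P : Subgroup G, IsPGroup p P → IsPermutation (M.ρ.comp P.subtype)

variable {p : ℕ}

section perm
variable {H : Type v} [Group H] {V W : Type u} [AddCommGroup V] [Module k V]
  [AddCommGroup W] [Module k W] {ρ : Representation k H V} {σ : Representation k H W}

lemma IsPermutation.of_equiv (h : IsPermutation ρ) (e : V ≃ₗ[k] W)
    (he : ∀ g v, e (ρ g v) = σ g (e v)) : IsPermutation σ := by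
  obtain ⟨X, _, b, hb⟩ := h
  refine ⟨X, inferInstance, b.map e, fun g x => ?_⟩
  rw [Module.Basis.map_apply, ← he, hb, Module.Basis.map_apply]

lemma IsPermutation.tprod (h : IsPermutation ρ) (h' : IsPermutation σ) :
    IsPermutation (ρ.tprod σ) := by
  obtain ⟨X, _, b, hb⟩ := h
  obtain ⟨Y, _, c, hc⟩ := h'
  refine ⟨X × Y, inferInstance, b.tensorProduct c, fun g x => ?_⟩
  rw [Module.Basis.tensorProduct_apply', Representation.tprod_apply, TensorProduct.map_tmul, hb, hc,
    Module.Basis.tensorProduct_apply']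
  rfl

lemma IsPermutation.dual [Module.Finite k V] (h : IsPermutation ρ) : IsPermutation ρ.dual := by
  classical
  obtain ⟨X, _, b, hb⟩ := h
  have := Module.Finite.finite_basis b
  have := Fintype.ofFinite X
  refine ⟨X, inferInstance, b.dualBasis, fun g x => b.ext fun y => ?_⟩
  change b.dualBasis x (ρ g⁻¹ (b y)) = _
  rw [hb, b.dualBasis_apply_self, b.dualBasis_apply_self]
  simp only [inv_smul_eq_iff]

lemma IsPermutation.of_subsingleton [Subsingleton V] : IsPermutation ρ := by
  let _ : MulAction H PEmpty.{u+1} := { smul := fun _ x => x, one_smul := nofun, mul_smul := nofun }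
  exact ⟨PEmpty, inferInstance, Module.Basis.empty V, nofun⟩

lemma IsPermutation.trivial : IsPermutation (Representation.trivial k H k) := by
  let _ : MulAction H PUnit.{u+1} := { smul := fun _ x => x, one_smul := fun _ => rfl, mul_smul := fun _ _ _ => rfl }
  exact ⟨PUnit, inferInstance, Module.Basis.singleton _ _, fun _ _ => rfl⟩

lemma IsPermutation.of_decomp {ι : Type} (s : Finset ι) {Y : ι → Type u}
    [∀ i, AddCommGroup (Y i)] [∀ i, Module k (Y i)] {τ : ∀ i, Representation k H (Y i)}
    (h : ∀ i, IsPermutation (τ i)) (f : ∀ i, Y i →ₗ[k] V) (q : ∀ i, V →ₗ[k] Y i)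
    (hf : ∀ i g y, f i (τ i g y) = ρ g (f i y))
    (h₁ : ∀ i y, q i (f i y) = y) (h₂ : ∀ i j y, i ≠ j → q j (f i y) = 0)
    (h₃ : ∀ v, ∑ i ∈ s, f i (q i v) = v) : IsPermutation ρ := by
  classical
  choose X inst b hb using h
  let e : V ≃ₗ[k] (∀ i : s, Y i) := LinearEquiv.ofLinearMap
    (LinearMap.pi fun i : s => q i) (∑ i : s, f i ∘ₗ LinearMap.proj i)
    (by
      refine LinearMap.ext fun y => funext fun j => ?_
      simp only [LinearMap.comp_apply, LinearMap.pi_apply, LinearMap.sum_apply, map_sum,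
        LinearMap.proj_apply, LinearMap.id_apply]
      rw [Finset.sum_eq_single j]
      · exact h₁ _ _
      · intro i _ hi
        exact h₂ _ _ _ (fun h => hi (Subtype.ext h))
      · simp)
    (by
      refine LinearMap.ext fun v => ?_
      simp only [LinearMap.comp_apply, LinearMap.pi_apply, LinearMap.sum_apply,
        LinearMap.proj_apply, LinearMap.id_apply]
      exact (Finset.sum_coe_sort s (fun i => f i (q i v))).trans (h₃ v))
  let B := (Pi.basis (fun i : s => b i)).map e.symm
  have hB : ∀ x : (Σ i : s, X i), B x = f x.1 (b x.1 x.2) := by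
    rintro ⟨i, x⟩
    simp only [B, Module.Basis.map_apply, Pi.basis_apply, e, LinearEquiv.symm_ofLinearMap, LinearEquiv.coe_ofLinearMap,
      LinearMap.sum_apply, LinearMap.comp_apply, LinearMap.proj_apply]
    rw [Finset.sum_eq_single i]
    · rw [Pi.single_eq_same]
    · intro j _ hj
      rw [Pi.single_eq_of_ne hj, map_zero]
    · simp
  refine ⟨Σ i : s, X i, inferInstance, B, fun g x => ?_⟩
  rw [hB, hB, ← hf, hb]
  rfl
end perm

lemma IsPPermutation.tensor {M N : Rep.{u} k G} (h : IsPPermutation p M) (h' : IsPPermutation p N) :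
    IsPPermutation p (M ⊗ N) := fun P hP =>
  ((h P hP).tprod (h' P hP)).of_equiv (LinearEquiv.refl _ _) fun _ _ => rfl

lemma IsPPermutation.dual {M : Rep.{u} k G} [Module.Finite k M] (h : IsPPermutation p M) :
    IsPPermutation p (dualRep M) := fun P hP =>
  (h P hP).dual.of_equiv (LinearEquiv.refl _ _) fun _ _ => rfl

lemma IsPPermutation.of_iso {M N : Rep.{u} k G} (h : IsPPermutation p M) (e : M ≅ N) :
    IsPPermutation p N := fun P hP =>
  (h P hP).of_equiv (Representation.equivOfIso e).toLinearEquiv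
    fun g v => Rep.hom_comm_apply e.hom (g : G) v

lemma IsPPermutation.of_isZero {M : Rep.{u} k G} (h : IsZero M) : IsPPermutation p M := fun P _ => by
  have := (Rep.isZero_iff k G M).1 h
  exact IsPermutation.of_subsingleton

lemma IsPPermutation.unit : IsPPermutation p (𝟙_ (Rep.{u} k G)) := fun _ _ => IsPermutation.trivial

lemma hom_sum_apply {M N : Rep.{u} k G} {ι : Type*} (s : Finset ι) (f : ι → (M ⟶ N)) (m : M) :
    (∑ i ∈ s, f i).hom m = ∑ i ∈ s, (f i).hom m :=
  map_sum (AddMonoidHom.mk' (fun f : M ⟶ N => f.hom m) (fun _ _ => rfl)) f s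

lemma isPPermutation_tens (hb : IsBounded C) (hC : ∀ n, IsPPermutation p (C.X n))
    (hD : ∀ n, IsPPermutation p (D.X n)) (n : ℤ) : IsPPermutation p ((tens C D).X n) := by
  obtain ⟨N, hN⟩ := hb
  intro P hP
  refine IsPermutation.of_decomp (Finset.Icc (-N) N) (Y := fun i => (C.X i ⊗ D.X (n - i) : Rep.{u} k G))
    (τ := fun i => (C.X i ⊗ D.X (n - i) : Rep.{u} k G).ρ.comp P.subtype)
    (fun i => ((hC i).tensor (hD (n - i))) P hP)
    (fun i => (inc C D i (n - i) n (by lia)).hom.toLinearMap)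
    (fun i => (proj C D i (n - i) n (by lia)).hom.toLinearMap) ?_ ?_ ?_ ?_
  · intro i g y
    exact Rep.hom_comm_apply (inc C D i (n - i) n (by lia)) (g : G) y
  · intro i y
    exact congr($(inc_proj (C := C) (D := D) i (n - i) n (by lia)).hom y)
  · intro i j y hij
    exact congr($(inc_proj_ne (C := C) (D := D) i (n - i) j (n - j) n (by lia) (by lia) hij).hom y)
  · intro v
    have := congr($(proj_inc_sum (D := D) hN n).hom v)
    rw [hom_sum_apply] at this
    exact this

lemma isFinite_tens (hb : IsBounded C) (hC : IsFinite C) (hD : IsFinite D) :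
    IsFinite (tens C D) := by
  obtain ⟨N, hN⟩ := hb
  intro n
  have h : ∀ i, Module.Finite k (C.X i ⊗ D.X (n - i) : Rep.{u} k G) := fun i => by
    have := hC i
    have := hD (n - i)
    exact Module.Finite.tensorProduct k (C.X i) (D.X (n - i))
  refine Module.Finite.of_surjective (M := ∀ i : Finset.Icc (-N) N, (C.X i ⊗ D.X (n - i) : Rep.{u} k G))
    (∑ i : Finset.Icc (-N) N, (inc C D i (n - i) n (by lia)).hom.toLinearMap ∘ₗ LinearMap.proj i)
    fun v => ⟨fun i => (proj C D i (n - i) n (by lia)).hom v, ?_⟩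
  have := congr($(proj_inc_sum (D := D) hN n).hom v)
  rw [hom_sum_apply] at this
  rw [LinearMap.sum_apply]
  exact (Finset.sum_coe_sort (Finset.Icc (-N) N)
    (fun i => (inc C D i (n - i) n (by lia)).hom ((proj C D i (n - i) n (by lia)).hom v))).trans this

lemma isBounded_tens (hC : IsBounded C) (hD : IsBounded D) : IsBounded (tens C D) := by
  obtain ⟨N, hN⟩ := hC
  obtain ⟨M, hM⟩ := hD
  refine ⟨N + M, fun n hn => ?_⟩
  rw [IsZero.iff_id_eq_zero]
  refine tens_hom_ext fun i j h => ?_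
  have hz : IsZero (C.X i ⊗ D.X j) := by
    by_cases hi : N < |i|
    · exact Functor.map_isZero (tensorRight (D.X j)) (hN i hi)
    · refine Functor.map_isZero (tensorLeft (C.X i)) (hM j ?_)
      have := abs_add_le i j
      rw [h] at this
      lia
  exact hz.eq_of_src _ _

lemma isBounded_dual (hC : IsBounded C) : IsBounded (dualComplex C) := by
  obtain ⟨N, hN⟩ := hC
  exact ⟨N, fun n hn => isZero_dualRep (hN (-n) (by rwa [abs_neg]))⟩

lemma isFinite_dual (hC : IsFinite C) : IsFinite (dualComplex C) := fun n => by
  have := hC (-n)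
  exact (inferInstance : Module.Finite k (Module.Dual k (C.X (-n))))

lemma unitComplex_iso : Nonempty ((unitComplex k G).X 0 ≅ 𝟙_ (Rep.{u} k G)) :=
  ⟨HomologicalComplex.singleObjXSelf _ _ _⟩

lemma isPPermutation_unit (n : ℤ) : IsPPermutation p ((unitComplex k G).X n) := by
  by_cases hn : n = 0
  · subst hn
    exact IsPPermutation.unit.of_iso unitComplex_iso.some.symm
  · exact .of_isZero (isZero_unitComplex hn)

lemma isFinite_unit : IsFinite (unitComplex k G) := by
  intro n
  by_cases hn : n = 0
  · subst hn
    exact Module.Finite.equiv (M := k)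
      (Representation.equivOfIso (unitComplex_iso (k := k) (G := G)).some.symm).toLinearEquiv
  · have := (Rep.isZero_iff _ _ _).1 (isZero_unitComplex (k := k) (G := G) hn)
    infer_instance

lemma isBounded_unit : IsBounded (unitComplex k G) :=
  ⟨0, fun n hn => isZero_unitComplex (abs_pos.1 hn)⟩

/-! ## The group of endotrivial complexes -/

/-- Bounded complexes of finitely generated `p`-permutation `kG`-modules. -/
structure PPermComplex (p : ℕ) (k : Type u) [Field k] (G : Type v) [Group G] where
  X : ChainComplex (Rep.{u} k G) ℤ
  bounded : IsBounded X
  finite : IsFinite X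
  pperm : ∀ n, IsPPermutation p (X.X n)

namespace PPermComplex

/-- Homotopy equivalence of complexes. -/
instance homotopySetoid : Setoid (PPermComplex p k G) where
  r C D := Nonempty (HomotopyEquiv C.X D.X)
  iseqv := ⟨fun _ => ⟨HomotopyEquiv.refl _⟩, fun ⟨f⟩ => ⟨f.symm⟩, fun ⟨f⟩ ⟨g⟩ => ⟨f.trans g⟩⟩

/-- Tensor product. -/
def tensor (C D : PPermComplex p k G) : PPermComplex p k G where
  X := tens C.X D.X
  bounded := isBounded_tens C.bounded D.bounded
  finite := isFinite_tens C.bounded C.finite D.finite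
  pperm := isPPermutation_tens C.bounded C.pperm D.pperm

/-- Dual complex. -/
def dual (C : PPermComplex p k G) : PPermComplex p k G where
  X := dualComplex C.X
  bounded := isBounded_dual C.bounded
  finite := isFinite_dual C.finite
  pperm n := by
    have := C.finite (-n)
    exact (C.pperm (-n)).dual

/-- The complex `k[0]`. -/
def unit (p : ℕ) (k : Type u) [Field k] (G : Type v) [Group G] : PPermComplex p k G where
  X := unitComplex k G
  bounded := isBounded_unit
  finite := isFinite_unit
  pperm := isPPermutation_unit

/-- The complex `C` is endotrivial if `C* ⊗ C` is homotopy equivalent to `k[0]`. -/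
def IsEndotrivial (C : PPermComplex p k G) : Prop :=
  Nonempty (HomotopyEquiv (tens (dualComplex C.X) C.X) (unitComplex k G))

end PPermComplex

/-- An isomorphism of complexes is a homotopy equivalence. -/
def equivOfIsIso (f : C ⟶ D) (h : IsIso f) : HomotopyEquiv C D :=
  HomotopyEquiv.ofIso (asIso f)

/-- Homotopy classes of bounded complexes of finitely generated `p`-permutation modules. -/
def HomotopyClass (p : ℕ) (k : Type u) [Field k] (G : Type v) [Group G] :=
  Quotient (PPermComplex.homotopySetoid (p := p) (k := k) (G := G))

namespace HomotopyClass

/-- The homotopy class of a complex. -/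
def mk (C : PPermComplex p k G) : HomotopyClass p k G := Quotient.mk _ C

lemma mk_eq_mk {C D : PPermComplex p k G} : mk C = mk D ↔ Nonempty (HomotopyEquiv C.X D.X) :=
  Quotient.eq

/-- The operation induced by the tensor product, written additively. -/
instance : Add (HomotopyClass p k G) :=
  ⟨Quotient.map₂ PPermComplex.tensor fun _ _ ⟨f⟩ _ _ ⟨g⟩ => ⟨tensEquiv f g⟩⟩

/-- The class of `k[0]`. -/
instance : Zero (HomotopyClass p k G) := ⟨mk (.unit p k G)⟩

/-- The operation induced by duality. -/
instance : Neg (HomotopyClass p k G) :=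
  ⟨Quotient.map PPermComplex.dual fun _ _ ⟨f⟩ => ⟨dualEquiv f⟩⟩

lemma mk_add (C D : PPermComplex p k G) : mk C + mk D = mk (C.tensor D) := rfl

lemma mk_neg (C : PPermComplex p k G) : - mk C = mk C.dual := rfl

lemma zero_def : (0 : HomotopyClass p k G) = mk (.unit p k G) := rfl

instance : AddCommMonoid (HomotopyClass p k G) where
  add_assoc := by
    rintro ⟨C⟩ ⟨D⟩ ⟨E⟩
    exact mk_eq_mk.2 ⟨HomotopyEquiv.ofIso (α_ C.X D.X E.X)⟩
  zero_add := by
    rintro ⟨C⟩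
    exact mk_eq_mk.2 ⟨HomotopyEquiv.ofIso (λ_ C.X)⟩
  add_zero := by
    rintro ⟨C⟩
    exact mk_eq_mk.2 ⟨HomotopyEquiv.ofIso (ρ_ C.X)⟩
  add_comm := by
    rintro ⟨C⟩ ⟨D⟩
    exact mk_eq_mk.2 ⟨HomotopyEquiv.ofIso (tensCommIso C.X D.X)⟩
  nsmul := nsmulRec

lemma neg_add_eq (x y : HomotopyClass p k G) : -(x + y) = -x + -y := by
  obtain ⟨C⟩ := x
  obtain ⟨D⟩ := y
  exact mk_eq_mk.2 ⟨(equivOfIsIso _ (isIso_dualTens C.bounded C.finite D.finite)).symm⟩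

lemma neg_zero_eq : -(0 : HomotopyClass p k G) = 0 :=
  mk_eq_mk.2 ⟨equivOfIsIso _ isIso_dualUnitHom⟩

end HomotopyClass

/-- The group `E_k(G)` of homotopy classes of endotrivial complexes. The group law is induced by
the tensor product and is written additively; the inverse of the class of `C` is the class of the
dual of `C`. -/
def EndotrivialGroup (p : ℕ) (k : Type u) [Field k] (G : Type v) [Group G] :=
  {x : HomotopyClass p k G // ∃ C : PPermComplex p k G, C.IsEndotrivial ∧ HomotopyClass.mk C = x}

namespace EndotrivialGroup

lemma isEndotrivial_iff (C : PPermComplex p k G) :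
    C.IsEndotrivial ↔ - HomotopyClass.mk C + HomotopyClass.mk C = 0 :=
  (HomotopyClass.mk_eq_mk (C := C.dual.tensor C) (D := .unit p k G)).symm

lemma exists_iff (x : HomotopyClass p k G) :
    (∃ C : PPermComplex p k G, C.IsEndotrivial ∧ HomotopyClass.mk C = x) ↔ -x + x = 0 := by
  constructor
  · rintro ⟨C, hC, rfl⟩
    exact (isEndotrivial_iff C).1 hC
  · obtain ⟨C⟩ := x
    exact fun h => ⟨C, (isEndotrivial_iff C).2 h, rfl⟩

instance : Add (EndotrivialGroup p k G) :=
  ⟨fun x y => ⟨x.1 + y.1, (exists_iff _).2 (by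
    rw [HomotopyClass.neg_add_eq, add_add_add_comm, (exists_iff _).1 x.2, (exists_iff _).1 y.2,
      add_zero])⟩⟩

instance : Zero (EndotrivialGroup p k G) :=
  ⟨⟨0, (exists_iff _).2 (by rw [HomotopyClass.neg_zero_eq, add_zero])⟩⟩

instance : Neg (EndotrivialGroup p k G) :=
  ⟨fun x => ⟨-x.1, (exists_iff _).2 (by
    rw [← HomotopyClass.neg_add_eq, (exists_iff _).1 x.2, HomotopyClass.neg_zero_eq])⟩⟩

instance : AddCommGroup (EndotrivialGroup p k G) where
  add_assoc x y z := Subtype.ext (add_assoc x.1 y.1 z.1)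
  zero_add x := Subtype.ext (zero_add x.1)
  add_zero x := Subtype.ext (add_zero x.1)
  add_comm x y := Subtype.ext (add_comm x.1 y.1)
  neg_add_cancel x := Subtype.ext ((exists_iff _).1 x.2)
  nsmul := nsmulRec
  zsmul := zsmulRec

end EndotrivialGroup

section map

universe w
variable {H : Type w} [Group H]

/-- Additive functors that preserve finitely generated `p`-permutation modules, and are compatible
with tensor products and duals of such modules and with the trivial module. -/
structure PreservesEndotrivial (p : ℕ) (F : Rep.{u} k G ⥤ Rep.{u} k H) [F.Additive] : Prop where
  finite (M : Rep.{u} k G) [Module.Finite k M] : Module.Finite k (F.obj M)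
  pperm (M : Rep.{u} k G) [Module.Finite k M] (h : IsPPermutation p M) : IsPPermutation p (F.obj M)
  tensor : ∃ T : TensorData F, ∀ M N : Rep.{u} k G, IsPPermutation p M → IsPPermutation p N →
    Module.Finite k M → Module.Finite k N → IsIso (T.μ M N)
  dual : ∃ T : DualData F, ∀ M : Rep.{u} k G, IsPPermutation p M → Module.Finite k M → IsIso (T.ν M)
  unit : Nonempty (F.obj (𝟙_ (Rep.{u} k G)) ≅ 𝟙_ (Rep.{u} k H))

variable {F : Rep.{u} k G ⥤ Rep.{u} k H} [F.Additive]

/-- Apply a functor to a complex of `p`-permutation modules. -/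
def PPermComplex.map (hF : PreservesEndotrivial p F) (C : PPermComplex p k G) :
    PPermComplex p k H where
  X := mapC F C.X
  bounded := by
    obtain ⟨N, hN⟩ := C.bounded
    exact ⟨N, fun n hn => F.map_isZero (hN n hn)⟩
  finite n := by
    have := C.finite n
    exact hF.finite (C.X.X n)
  pperm n := by
    have := C.finite n
    exact hF.pperm (C.X.X n) (C.pperm n)

/-- Apply a functor to a homotopy class. -/
def HomotopyClass.map (hF : PreservesEndotrivial p F) : HomotopyClass p k G →+ HomotopyClass p k H where
  toFun := Quotient.map (PPermComplex.map hF) fun _ _ ⟨f⟩ => ⟨F.mapHomotopyEquiv f⟩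
  map_zero' := mk_eq_mk.2 ⟨HomotopyEquiv.ofIso (mapUnit hF.unit.some)⟩
  map_add' := by
    rintro ⟨C⟩ ⟨D⟩
    obtain ⟨T, hT⟩ := hF.tensor
    exact mk_eq_mk.2 ⟨(equivOfIsIso _ (isIso_mapTens T C.bounded fun i j =>
      hT _ _ (C.pperm i) (D.pperm j) (C.finite i) (D.finite j))).symm⟩

lemma HomotopyClass.map_neg (hF : PreservesEndotrivial p F) (x : HomotopyClass p k G) :
    map hF (-x) = - map hF x := by
  obtain ⟨C⟩ := x
  obtain ⟨T, hT⟩ := hF.dual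
  exact mk_eq_mk.2 ⟨equivOfIsIso _ (isIso_mapDual T fun i => hT _ (C.pperm i) (C.finite i))⟩

/-- The group homomorphism `[C] ↦ [F C]`, where `F` is applied degree by degree. -/
def EndotrivialGroup.map (hF : PreservesEndotrivial p F) :
    EndotrivialGroup p k G →+ EndotrivialGroup p k H where
  toFun x := ⟨HomotopyClass.map hF x.1, (exists_iff _).2 (by
    rw [← HomotopyClass.map_neg, ← map_add, (exists_iff _).1 x.2, map_zero])⟩
  map_zero' := Subtype.ext (map_zero (HomotopyClass.map hF))
  map_add' x y := Subtype.ext (map_add (HomotopyClass.map hF) x.1 y.1)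

end map

/-! ## The Brauer construction -/

section traces

universe w
variable {H : Type v} [Group H] {H' : Type w} [Group H'] {V W : Type u} [AddCommGroup V] [Module k V]
  [AddCommGroup W] [Module k W]

/-- The relative trace `m ↦ ∑ x m`, with `x` running over representatives of the cosets `H / Q`.
On vectors fixed by `Q` it does not depend on the representatives. -/
def relTrace (σ : Representation k H V) (Q : Subgroup H) : V →ₗ[k] V :=
  ∑ᶠ x : H ⧸ Q, σ x.out

/-- The sum, over the proper subgroups `Q` of `H`, of the images `tr_Q^H (V^Q)`. -/
def traceSubmodule (σ : Representation k H V) : Submodule k V :=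
  ⨆ Q : {Q : Subgroup H // Q < ⊤},
    (Representation.invariants (σ.comp Q.1.subtype)).map (relTrace σ Q.1)

lemma relTrace_eq [Finite H] (σ : Representation k H V) (Q : Subgroup H) [Fintype (H ⧸ Q)] (v : V)
    (hv : ∀ q ∈ Q, σ q v = v) (r : H ⧸ Q → H) (hr : ∀ x, (r x : H ⧸ Q) = x) :
    relTrace σ Q v = ∑ x, σ (r x) v := by
  rw [relTrace, finsum_eq_sum_of_fintype, LinearMap.sum_apply]
  refine Finset.sum_congr rfl fun x _ => ?_
  have h : (r x)⁻¹ * x.out ∈ Q := QuotientGroup.eq.1 (by rw [hr, QuotientGroup.out_eq'])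
  conv_lhs => rw [← mul_inv_cancel_left (r x) x.out, map_mul, Module.End.mul_apply, hv _ h]

lemma relTrace_mem {σ : Representation k H V} {Q : Subgroup H} (hQ : Q < ⊤) {v : V}
    (hv : ∀ q ∈ Q, σ q v = v) : relTrace σ Q v ∈ traceSubmodule σ :=
  Submodule.mem_iSup_of_mem (p := fun Q : {Q : Subgroup H // Q < ⊤} =>
    (Representation.invariants (σ.comp Q.1.subtype)).map (relTrace σ Q.1)) ⟨Q, hQ⟩
    ⟨v, fun q => hv q.1 q.2, rfl⟩

lemma traceSubmodule_le {σ : Representation k H V} {S : Submodule k V}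
    (h : ∀ Q < ⊤, ∀ v, (∀ q ∈ Q, σ q v = v) → relTrace σ Q v ∈ S) : traceSubmodule σ ≤ S := by
  refine iSup_le fun Q => Submodule.map_le_iff_le_comap.2 fun v hv => ?_
  exact h Q.1 Q.2 v fun q hq => hv ⟨q, hq⟩

lemma map_traceSubmodule [Finite H] {σ : Representation k H V} {τ : Representation k H' W}
    (φ : H ≃* H') (e : V →ₗ[k] W) (he : ∀ h v, e (σ h v) = τ (φ h) (e v)) :
    traceSubmodule σ ≤ (traceSubmodule τ).comap e := by
  refine traceSubmodule_le fun Q hQ v hv => ?_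
  have : Finite H' := Finite.of_equiv H φ.toEquiv
  let _ : Fintype (H ⧸ Q) := Fintype.ofFinite _
  let _ : Fintype (H' ⧸ Q.map φ.toMonoidHom) := Fintype.ofFinite _
  let E : H ⧸ Q ≃ H' ⧸ Q.map φ.toMonoidHom := Quotient.congr φ.toEquiv fun a b => by
    rw [QuotientGroup.leftRel_apply, QuotientGroup.leftRel_apply]
    change _ ↔ (φ a)⁻¹ * φ b ∈ _
    rw [← map_inv, ← map_mul, Subgroup.mem_map]
    exact ⟨fun h => ⟨_, h, rfl⟩, fun ⟨x, hx, h⟩ => by rwa [← φ.injective h]⟩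
  have hv' : ∀ q ∈ Q.map φ.toMonoidHom, τ q (e v) = e v := by
    rintro _ ⟨q, hq, rfl⟩
    change τ (φ q) (e v) = e v
    rw [← he, hv q hq]
  have key : e (relTrace σ Q v) = relTrace τ (Q.map φ.toMonoidHom) (e v) := by
    rw [relTrace_eq σ Q v hv (fun x => x.out) (fun x => QuotientGroup.out_eq' x),
      relTrace_eq τ _ (e v) hv' (fun y => φ (E.symm y).out), map_sum]
    · refine Fintype.sum_equiv E _ _ fun x => ?_
      rw [he, Equiv.symm_apply_apply]
    · intro y
      obtain ⟨x, rfl⟩ := E.surjective y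
      rw [Equiv.symm_apply_apply]
      conv_rhs => rw [← QuotientGroup.out_eq' x]
      rfl
  rw [Submodule.mem_comap, key]
  refine relTrace_mem (lt_top_iff_ne_top.2 fun h => hQ.ne ?_) hv'
  refine Subgroup.map_injective φ.injective (h.trans ?_)
  exact (Subgroup.map_top_of_surjective _ φ.surjective).symm

lemma card_quotient_eq_zero [Fact p.Prime] [CharP k p] [Finite H] (hH : IsPGroup p H) (Q : Subgroup H)
    (hQ : Q < ⊤) : (Nat.card (H ⧸ Q) : k) = 0 := by
  rw [CharP.cast_eq_zero_iff k p]
  obtain ⟨n, hn⟩ := hH.index Q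
  change p ∣ Q.index
  rw [hn]
  refine dvd_pow_self p fun h0 => hQ.ne ?_
  rw [h0, pow_zero, Subgroup.index_eq_one] at hn
  exact hn

lemma traceSubmodule_le_ker [Fact p.Prime] [CharP k p] [Finite H] (hH : IsPGroup p H)
    {σ : Representation k H V} (f : V →ₗ[k] k) (hf : ∀ h v, f (σ h v) = f v) :
    traceSubmodule σ ≤ LinearMap.ker f := by
  refine traceSubmodule_le fun Q hQ v hv => ?_
  let _ : Fintype (H ⧸ Q) := Fintype.ofFinite _
  rw [LinearMap.mem_ker, relTrace_eq σ Q v hv (fun x => x.out) (fun x => QuotientGroup.out_eq' x),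
    map_sum, Finset.sum_congr rfl (fun x _ => hf _ v), Finset.sum_const, Finset.card_univ,
    ← Nat.card_eq_fintype_card, ← Nat.cast_smul_eq_nsmul k, card_quotient_eq_zero hH Q hQ, zero_smul]

section basis

variable [Finite H] {σ : Representation k H V} {X : Type u} [MulAction H X] [Fintype X]
  {b : Module.Basis X k V}

lemma coord_apply (hb : ∀ (h : H) x, σ h (b x) = b (h • x)) (x : X) (h : H) (v : V) :
    b.coord x (σ h v) = b.coord (h⁻¹ • x) v := by
  classical
  have : b.coord x ∘ₗ σ h = b.coord (h⁻¹ • x) := b.ext fun y => by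
    rw [LinearMap.comp_apply, hb, b.coord_apply, b.coord_apply, b.repr_self_apply,
      b.repr_self_apply]
    simp only [eq_inv_smul_iff]
  exact congr($this v)

lemma sub_mem_trace (hb : ∀ (h : H) x, σ h (b x) = b (h • x)) [Fintype (MulAction.fixedPoints H X)]
    (v : V) (hv : ∀ h, σ h v = v) :
    v - ∑ x : MulAction.fixedPoints H X, b.coord x.1 v • b x.1 ∈ traceSubmodule σ := by
  classical
  have hc : ∀ (h : H) x, b.coord (h • x) v = b.coord x v := fun h x => by
    conv_lhs => rw [← hv h]
    rw [coord_apply hb, inv_smul_smul]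
  let F : X → V := fun x => if x ∈ MulAction.fixedPoints H X then 0 else b.coord x v • b x
  have h1 : v - ∑ x : MulAction.fixedPoints H X, b.coord x.1 v • b x.1 = ∑ x, F x := by
    rw [sub_eq_iff_eq_add]
    conv_lhs => rw [← b.sum_repr v]
    have h2 : ∑ x : MulAction.fixedPoints H X, b.coord x.1 v • b x.1 =
        ∑ x, if x ∈ MulAction.fixedPoints H X then b.coord x v • b x else 0 := by
      rw [← Finset.sum_filter]
      exact (Finset.sum_subtype (p := fun x => x ∈ MulAction.fixedPoints H X)
        (Finset.univ.filter fun x => x ∈ MulAction.fixedPoints H X)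
        (fun x => by rw [Finset.mem_filter]; exact and_iff_right (Finset.mem_univ x))
        (fun x => b.coord x v • b x)).symm
    rw [h2, ← Finset.sum_add_distrib]
    refine Finset.sum_congr rfl fun x _ => ?_
    simp only [F]
    split_ifs <;> simp
  rw [h1]
  let _ : ∀ ω : MulAction.orbitRel.Quotient H X, Fintype (H ⧸ MulAction.stabilizer H ω.out) :=
    fun _ => Fintype.ofFinite _
  let _ : Fintype (MulAction.orbitRel.Quotient H X) := Fintype.ofFinite _
  let E := MulAction.selfEquivSigmaOrbitsQuotientStabilizer H X
  have hE : ∀ ω (y : H), E.symm ⟨ω, (y : H ⧸ MulAction.stabilizer H ω.out)⟩ = y • ω.out :=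
    fun ω y => rfl
  rw [← Fintype.sum_equiv E.symm (fun z => F (E.symm z)) F (fun z => rfl), Fintype.sum_sigma]
  refine Submodule.sum_mem _ fun ω _ => ?_
  have h3 : ∀ y : H ⧸ MulAction.stabilizer H ω.out, E.symm ⟨ω, y⟩ = y.out • ω.out := fun y => by
    conv_lhs => rw [← QuotientGroup.out_eq' y]
    exact hE ω y.out
  by_cases hω : ω.out ∈ MulAction.fixedPoints H X
  · rw [Finset.sum_eq_zero]
    · exact zero_mem _
    · intro y _
      rw [h3, hω]
      exact if_pos hω
  · have h4 : ∑ y, F (E.symm ⟨ω, y⟩) =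
        b.coord ω.out v • relTrace σ (MulAction.stabilizer H ω.out) (b ω.out) := by
      rw [relTrace_eq σ _ _ _ (fun x => x.out) (fun x => QuotientGroup.out_eq' x), Finset.smul_sum]
      · refine Finset.sum_congr rfl fun y _ => ?_
        rw [h3, hb]
        simp only [F]
        rw [if_neg, hc]
        intro h5
        refine hω fun g => ?_
        have h6 := h5 (y.out * g * y.out⁻¹)
        rw [mul_smul, inv_smul_smul, mul_smul] at h6
        exact smul_left_cancel _ h6
      · intro q hq
        rw [hb, MulAction.mem_stabilizer_iff.1 hq]
    rw [h4]
    refine Submodule.smul_mem _ _ (relTrace_mem (lt_top_iff_ne_top.2 fun h => hω fun g => ?_) ?_)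
    · exact MulAction.mem_stabilizer_iff.1 (h ▸ Subgroup.mem_top g)
    · intro q hq
      rw [hb, MulAction.mem_stabilizer_iff.1 hq]

end basis

end traces

section brauerModule

variable {H : Type v} [Group H] {V W : Type u} [AddCommGroup V] [Module k V]
  [AddCommGroup W] [Module k W]

/-- The Brauer quotient `V(H) = V^H / ∑_{Q < H} tr_Q^H (V^Q)`. -/
abbrev BrauerQuotient (σ : Representation k H V) : Type u :=
  σ.invariants ⧸ (traceSubmodule σ).comap σ.invariants.subtype

/-- The projection of `V^H` onto the Brauer quotient. -/
def brauerMk (σ : Representation k H V) : σ.invariants →ₗ[k] BrauerQuotient σ :=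
  Submodule.mkQ _

lemma brauerMk_eq_iff {σ : Representation k H V} {v w : σ.invariants} :
    brauerMk σ v = brauerMk σ w ↔ v.1 - w.1 ∈ traceSubmodule σ :=
  Submodule.Quotient.eq _

lemma brauerMk_surjective (σ : Representation k H V) : Function.Surjective (brauerMk σ) :=
  Submodule.mkQ_surjective _

lemma brauer_hom_ext {σ : Representation k H V} {f g : BrauerQuotient σ →ₗ[k] W}
    (h : ∀ v, f (brauerMk σ v) = g (brauerMk σ v)) : f = g :=
  Submodule.linearMap_qext _ (LinearMap.ext h)

/-- A linear map out of the Brauer quotient. -/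
def brauerLift {σ : Representation k H V} (f : σ.invariants →ₗ[k] W)
    (hf : ∀ v, v.1 ∈ traceSubmodule σ → f v = 0) : BrauerQuotient σ →ₗ[k] W :=
  Submodule.liftQ _ f fun v hv => hf v hv

lemma brauerLift_mk {σ : Representation k H V} (f : σ.invariants →ₗ[k] W)
    (hf : ∀ v, v.1 ∈ traceSubmodule σ → f v = 0) (v : σ.invariants) :
    brauerLift f hf (brauerMk σ v) = f v := rfl

/-- The Brauer quotient is functorial. -/
def brauerMap [Finite H] {σ : Representation k H V} {τ : Representation k H W} (f : V →ₗ[k] W)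
    (hf : ∀ h v, f (σ h v) = τ h (f v)) : BrauerQuotient σ →ₗ[k] BrauerQuotient τ :=
  brauerLift (brauerMk τ ∘ₗ (f ∘ₗ σ.invariants.subtype).codRestrict τ.invariants
    fun v h => by rw [LinearMap.comp_apply, Submodule.subtype_apply, ← hf, v.2 h]) fun v hv => by
      have h1 : f v.1 ∈ traceSubmodule τ := map_traceSubmodule (MulEquiv.refl H) f hf hv
      rw [← map_zero (brauerMk τ), LinearMap.comp_apply, brauerMk_eq_iff]
      rw [ZeroMemClass.coe_zero, sub_zero]
      exact h1

lemma brauerMap_mk [Finite H] {σ : Representation k H V} {τ : Representation k H W} (f : V →ₗ[k] W)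
    (hf : ∀ h v, f (σ h v) = τ h (f v)) (v : σ.invariants) :
    brauerMap f hf (brauerMk σ v) =
      brauerMk τ ⟨f v.1, fun h => (hf h v.1).symm.trans (congrArg f (v.2 h))⟩ := rfl

section basis

variable [Fact p.Prime] [CharP k p] [Finite H] {σ : Representation k H V} {X : Type u}
  [MulAction H X] [Finite X] {b : Module.Basis X k V}

lemma exists_brauerBasis (hH : IsPGroup p H) (hb : ∀ (h : H) x, σ h (b x) = b (h • x)) :
    ∃ B : Module.Basis (MulAction.fixedPoints H X) k (BrauerQuotient σ),
      ∀ x, B x = brauerMk σ ⟨b x.1, fun h => by rw [hb, x.2 h]⟩ := by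
  classical
  have := Fintype.ofFinite X
  have := Fintype.ofFinite (MulAction.fixedPoints H X)
  have hx : ∀ x : MulAction.fixedPoints H X, ∀ h v, b.coord x.1 (σ h v) = b.coord x.1 v :=
    fun x h v => by rw [coord_apply hb, x.2]
  let e₁ : BrauerQuotient σ →ₗ[k] (MulAction.fixedPoints H X → k) :=
    LinearMap.pi fun x => brauerLift (b.coord x.1 ∘ₗ σ.invariants.subtype) fun v hv =>
      traceSubmodule_le_ker hH (b.coord x.1) (hx x) hv
  let c : MulAction.fixedPoints H X → BrauerQuotient σ := fun x =>
    brauerMk σ ⟨b x.1, fun h => by rw [hb, x.2 h]⟩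
  let e₂ : (MulAction.fixedPoints H X → k) →ₗ[k] BrauerQuotient σ := Fintype.linearCombination k c
  have hc : ∀ x, e₁ (c x) = Pi.single x 1 := fun x => funext fun y => by
    change b.coord y.1 (b x.1) = _
    rw [b.coord_apply, b.repr_self_apply, Pi.single_apply]
    simp only [Subtype.ext_iff, eq_comm]
  have h₁ : e₁ ∘ₗ e₂ = LinearMap.id := by
    refine LinearMap.pi_ext' fun x => LinearMap.ext_ring ?_
    change e₁ (e₂ (Pi.single x 1)) = Pi.single x 1
    simp only [e₂]
    rw [Fintype.linearCombination_apply_single, one_smul, hc]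
  have h₂ : e₂ ∘ₗ e₁ = LinearMap.id := by
    refine brauer_hom_ext fun v => ?_
    change e₂ (e₁ (brauerMk σ v)) = brauerMk σ v
    simp only [e₂]
    rw [Fintype.linearCombination_apply]
    simp only [c, ← map_smul]
    rw [← map_sum, eq_comm, brauerMk_eq_iff]
    have := sub_mem_trace hb v.1 v.2
    rw [Submodule.coe_sum]
    exact this
  refine ⟨Module.Basis.ofEquivFun (LinearEquiv.ofLinearMap e₁ e₂ h₁ h₂), fun x => ?_⟩
  rw [Module.Basis.coe_ofEquivFun]
  change e₂ (Pi.single x 1) = c x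
  simp only [e₂]
  rw [Fintype.linearCombination_apply_single, one_smul]

end basis

end brauerModule

section brauerFunctor

variable [Finite G] (P : Subgroup G) [P.Normal] {V : Type u} [AddCommGroup V] [Module k V]

lemma brauer_le_comap (ρ : Representation k G V) (g : G ⧸ P) :
    (traceSubmodule (ρ.comp P.subtype)).comap (Representation.invariants (ρ.comp P.subtype)).subtype ≤
      ((traceSubmodule (ρ.comp P.subtype)).comap (Representation.invariants (ρ.comp P.subtype)).subtype).comap
        (ρ.quotientToInvariants P g) := by
  obtain ⟨g, rfl⟩ := QuotientGroup.mk_surjective g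
  intro v hv
  refine map_traceSubmodule (σ := ρ.comp P.subtype) (τ := ρ.comp P.subtype) (MulAut.conjNormal g) (ρ g)
    (fun h w => ?_) hv
  change ρ g (ρ h.1 w) = ρ (MulAut.conjNormal g h).1 (ρ g w)
  rw [← Module.End.mul_apply, ← Module.End.mul_apply, ← map_mul, ← map_mul,
    MulAut.conjNormal_apply, inv_mul_cancel_right]

/-- The action of `G / P` on the Brauer quotient `V(P)`, for `P` normal in `G`. -/
def brauerRho (ρ : Representation k G V) :
    Representation k (G ⧸ P) (BrauerQuotient (ρ.comp P.subtype)) :=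
  (ρ.quotientToInvariants P).quotient _ (brauer_le_comap P ρ)

lemma invariant_smul {ρ : Representation k G V} (g : G) {v : V}
    (hv : v ∈ (Representation.invariants (ρ.comp P.subtype))) : ρ g v ∈ (Representation.invariants (ρ.comp P.subtype)) :=
  Representation.le_comap_invariants ρ P g hv

lemma brauerRho_mk (ρ : Representation k G V) (g : G) (v : (Representation.invariants (ρ.comp P.subtype))) :
    brauerRho P ρ (g : G ⧸ P) (brauerMk _ v) = brauerMk _ ⟨ρ g v.1, invariant_smul P g v.2⟩ := rfl

/-- The Brauer construction `M(P)`, as a `k[G / P]`-module, for `P` normal in `G`. -/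
abbrev brauerRep (M : Rep.{u} k G) : Rep.{u} k (G ⧸ P) := Rep.of (brauerRho P M.ρ)

/-- The Brauer construction at a normal subgroup `P`, as a functor to `k[G / P]`-modules. -/
def brauerFunctor : Rep.{u} k G ⥤ Rep.{u} k (G ⧸ P) where
  obj M := brauerRep P M
  map {M N} f := Rep.ofHom ⟨brauerMap f.hom.toLinearMap
      fun h v => Rep.hom_comm_apply f (h : G) v, fun g => by
    obtain ⟨g, rfl⟩ := QuotientGroup.mk_surjective g
    refine brauer_hom_ext fun v => ?_
    change brauerMk _ ⟨f.hom (M.ρ g v.1), _⟩ = brauerMk _ ⟨N.ρ g (f.hom v.1), _⟩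
    congr 2
    exact Rep.hom_comm_apply f g v.1⟩
  map_id M := Rep.hom_ext (Representation.IntertwiningMap.ext (brauer_hom_ext fun _ => rfl))
  map_comp f g := Rep.hom_ext (Representation.IntertwiningMap.ext (brauer_hom_ext fun _ => rfl))

instance : (brauerFunctor (k := k) P).Additive where
  map_add := Rep.hom_ext (Representation.IntertwiningMap.ext (brauer_hom_ext fun _ => rfl))

end brauerFunctor

section brauerTensor

variable {H : Type v} [Group H] [Finite H] {V W : Type u} [AddCommGroup V] [Module k V]
  [AddCommGroup W] [Module k W]

/-- The bilinear map `(v, w) ↦ [v ⊗ w]`. -/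
def brauerPair (σ : Representation k H V)
    (τ : Representation k H W) :
    σ.invariants →ₗ[k] τ.invariants →ₗ[k] BrauerQuotient (σ.tprod τ) :=
  LinearMap.mk₂ k (fun v w => brauerMk (σ.tprod τ) ⟨v.1 ⊗ₜ w.1, fun h => by
    rw [Representation.tprod_apply, TensorProduct.map_tmul, v.2 h, w.2 h]⟩)
    (fun v v' w => by
      rw [← map_add]; exact congrArg _ (Subtype.ext (TensorProduct.add_tmul ..)))
    (fun c v w => by
      rw [← map_smul]; exact congrArg _ (Subtype.ext (TensorProduct.smul_tmul' ..)))
    (fun v w w' => by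
      rw [← map_add]; exact congrArg _ (Subtype.ext (TensorProduct.tmul_add ..)))
    (fun c v w => by
      rw [← map_smul]; exact congrArg _ (Subtype.ext (TensorProduct.tmul_smul ..)))

lemma brauerPair_left (σ : Representation k H V)
    (τ : Representation k H W) (v : σ.invariants) (hv : v.1 ∈ traceSubmodule σ) :
    brauerPair σ τ v = 0 := by
  refine LinearMap.ext fun w => (brauerMk_eq_iff (w := 0)).2 ?_
  rw [ZeroMemClass.coe_zero, sub_zero]
  exact map_traceSubmodule (τ := σ.tprod τ) (MulEquiv.refl H) ((TensorProduct.mk k V W).flip w.1)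
    (fun h v => by
      change _ = (σ.tprod τ h) (v ⊗ₜ w.1)
      rw [Representation.tprod_apply, TensorProduct.map_tmul, w.2 h]; rfl) hv

lemma brauerPair_right (σ : Representation k H V)
    (τ : Representation k H W) (v : σ.invariants) (w : τ.invariants)
    (hw : w.1 ∈ traceSubmodule τ) : brauerPair σ τ v w = 0 := by
  refine (brauerMk_eq_iff (w := 0)).2 ?_
  rw [ZeroMemClass.coe_zero, sub_zero]
  exact map_traceSubmodule (τ := σ.tprod τ) (MulEquiv.refl H) (TensorProduct.mk k V W v.1)
    (fun h w => by
      change _ = (σ.tprod τ h) (v.1 ⊗ₜ w)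
      rw [Representation.tprod_apply, TensorProduct.map_tmul, v.2 h]; rfl) hw

/-- The natural map `V(H) ⊗ W(H) → (V ⊗ W)(H)`. -/
def brauerTensor (σ : Representation k H V)
    (τ : Representation k H W) :
    TensorProduct k (BrauerQuotient σ) (BrauerQuotient τ) →ₗ[k] BrauerQuotient (σ.tprod τ) :=
  TensorProduct.lift (brauerLift (LinearMap.flip (brauerLift (brauerPair σ τ).flip
    fun w hw => LinearMap.ext fun v => brauerPair_right σ τ v w hw) ) fun v hv =>
      brauer_hom_ext fun w => congr($(brauerPair_left σ τ v hv) w))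

lemma brauerTensor_mk (σ : Representation k H V)
    (τ : Representation k H W) (v : σ.invariants) (w : τ.invariants) :
    brauerTensor σ τ (brauerMk σ v ⊗ₜ brauerMk τ w) = brauerMk (σ.tprod τ) ⟨v.1 ⊗ₜ w.1, fun h => by
      rw [Representation.tprod_apply, TensorProduct.map_tmul, v.2 h, w.2 h]⟩ := rfl

/-- The natural map `(V*)(H) → V(H)*`. -/
def brauerDual [Fact p.Prime] [CharP k p] (hH : IsPGroup p H) (σ : Representation k H V) :
    BrauerQuotient σ.dual →ₗ[k] Module.Dual k (BrauerQuotient σ) :=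
  brauerLift (LinearMap.flip (brauerLift (LinearMap.mk₂ k (fun (v : σ.invariants) (f : σ.dual.invariants) =>
    (f.1 : Module.Dual k V) v.1) (fun v v' f => map_add (f.1 : Module.Dual k V) v.1 v'.1)
    (fun c v f => map_smul (f.1 : Module.Dual k V) c v.1) (fun _ _ _ => rfl) (fun _ _ _ => rfl))
    fun v hv => LinearMap.ext fun f => by
      refine traceSubmodule_le_ker hH (f.1 : Module.Dual k V) (fun h w => ?_) hv
      have h1 : (f.1 : Module.Dual k V) (σ h⁻¹⁻¹ w) = (f.1 : Module.Dual k V) w :=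
        congr($(f.2 h⁻¹) w)
      rwa [inv_inv] at h1)) fun f hf => brauer_hom_ext fun v => by
        change (f.1 : Module.Dual k V) v.1 = 0
        exact traceSubmodule_le_ker hH (σ := σ.dual) (Module.Dual.eval k V v.1) (fun h w => by
          change w (σ h⁻¹ v.1) = w v.1
          rw [v.2 h⁻¹]) hf

lemma brauerDual_mk [Fact p.Prime] [CharP k p] (hH : IsPGroup p H) (σ : Representation k H V)
    (f : σ.dual.invariants) (v : σ.invariants) :
    brauerDual hH σ (brauerMk _ f) (brauerMk _ v) = (f.1 : Module.Dual k V) v.1 := rfl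

end brauerTensor

section brauerPreserves

variable [Finite G] (P : Subgroup G) [P.Normal]

lemma brauer_rep_hom_ext {M : Rep.{u} k G} {N : Rep.{u} k (G ⧸ P)} {f g : brauerRep P M ⟶ N}
    (h : ∀ v, f.hom (brauerMk _ v) = g.hom (brauerMk _ v)) : f = g :=
  Rep.hom_ext (Representation.IntertwiningMap.ext (brauer_hom_ext h))

lemma brauer_tensor_ext {M N : Rep.{u} k G} {L : Rep.{u} k (G ⧸ P)}
    {f g : brauerRep P M ⊗ brauerRep P N ⟶ L}
    (h : ∀ v w, f.hom (brauerMk (M.ρ.comp P.subtype) v ⊗ₜ[k] brauerMk (N.ρ.comp P.subtype) w) =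
      g.hom (brauerMk (M.ρ.comp P.subtype) v ⊗ₜ[k] brauerMk (N.ρ.comp P.subtype) w)) : f = g :=
  hom_ext_tensor fun x y => by
    obtain ⟨v, rfl⟩ := brauerMk_surjective _ x
    obtain ⟨w, rfl⟩ := brauerMk_surjective _ y
    exact h v w

/-- The natural map `M(P) ⊗ N(P) ⟶ (M ⊗ N)(P)`. -/
def brauerTensorHom (M N : Rep.{u} k G) :
    brauerRep P M ⊗ brauerRep P N ⟶ brauerRep P (M ⊗ N) :=
  Rep.ofHom ⟨brauerTensor (M.ρ.comp P.subtype) (N.ρ.comp P.subtype), fun g => by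
    obtain ⟨g, rfl⟩ := QuotientGroup.mk_surjective g
    refine TensorProduct.ext' fun x y => ?_
    obtain ⟨v, rfl⟩ := brauerMk_surjective _ x
    obtain ⟨w, rfl⟩ := brauerMk_surjective _ y
    rfl⟩

/-- The Brauer construction and tensor products. -/
def brauerTensorData : TensorData (brauerFunctor (k := k) P) where
  μ M N := brauerTensorHom P M N
  μ_left _ _ := brauer_tensor_ext P fun _ _ => rfl
  μ_right _ _ _ _ := brauer_tensor_ext P fun _ _ => rfl

/-- The natural map `(M*)(P) ⟶ M(P)*`. -/
def brauerDualHom [Fact p.Prime] [CharP k p] (hP : IsPGroup p P) (M : Rep.{u} k G) :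
    brauerRep P (dualRep M) ⟶ dualRep (brauerRep P M) :=
  Rep.ofHom ⟨brauerDual hP (M.ρ.comp P.subtype), fun g => by
    obtain ⟨g, rfl⟩ := QuotientGroup.mk_surjective g
    refine brauer_hom_ext fun f => brauer_hom_ext fun v => ?_
    rfl⟩

/-- The Brauer construction and duals. -/
def brauerDualData [Fact p.Prime] [CharP k p] (hP : IsPGroup p P) :
    DualData (brauerFunctor (k := k) P) where
  ν M := brauerDualHom P hP M
  ν_nat _ := brauer_rep_hom_ext P fun _ => brauer_hom_ext fun _ => rfl

lemma bijective_of_basis {ι κ V W : Type*} [AddCommGroup V] [Module k V] [AddCommGroup W] [Module k W]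
    (B : Module.Basis ι k V) (B' : Module.Basis κ k W) (e : ι ≃ κ) (f : V →ₗ[k] W)
    (h : ∀ i, f (B i) = B' (e i)) : Function.Bijective f := by
  have : f = (B.equiv B' e).toLinearMap := B.ext fun i => by
    rw [h, LinearEquiv.coe_coe, Module.Basis.equiv_apply]
  rw [this]
  exact (B.equiv B' e).bijective

lemma isIso_brauerTensor [Fact p.Prime] [CharP k p] (hP : IsPGroup p P) {M N : Rep.{u} k G}
    (hM : IsPPermutation p M) (hN : IsPPermutation p N) [Module.Finite k M] [Module.Finite k N] :
    IsIso (brauerTensorHom P M N) := by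
  obtain ⟨X, _, b, hb⟩ := hM P hP
  obtain ⟨Y, _, c, hc⟩ := hN P hP
  have := Module.Finite.finite_basis b
  have := Module.Finite.finite_basis c
  obtain ⟨B, hB⟩ := exists_brauerBasis hP hb
  obtain ⟨B', hB'⟩ := exists_brauerBasis hP hc
  have hbc : ∀ (h : P) (x : X × Y), ((M ⊗ N).ρ.comp P.subtype) h (b.tensorProduct c x) =
      b.tensorProduct c (h • x) := fun h x => by
    rw [Module.Basis.tensorProduct_apply', Module.Basis.tensorProduct_apply']
    change M.ρ h.1 (b x.1) ⊗ₜ[k] N.ρ h.1 (c x.2) = b (h • x.1) ⊗ₜ c (h • x.2)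
    rw [← hb, ← hc]
    rfl
  obtain ⟨B'', hB''⟩ := exists_brauerBasis (V := (M ⊗ N : Rep.{u} k G)) hP hbc
  let e : MulAction.fixedPoints P X × MulAction.fixedPoints P Y ≃ MulAction.fixedPoints P (X × Y) :=
    { toFun := fun x => ⟨(x.1.1, x.2.1), fun h => Prod.ext (x.1.2 h) (x.2.2 h)⟩
      invFun := fun x => (⟨x.1.1, fun h => congrArg Prod.fst (x.2 h)⟩,
        ⟨x.1.2, fun h => congrArg Prod.snd (x.2 h)⟩)
      left_inv := fun x => rfl
      right_inv := fun x => rfl }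
  refine isIso_of_bijective (f := brauerTensorHom P M N) ?_
  refine bijective_of_basis (B.tensorProduct B') B'' e
    (brauerTensor (M.ρ.comp P.subtype) (N.ρ.comp P.subtype)) fun x => ?_
  rw [Module.Basis.tensorProduct_apply', hB, hB']
  refine (brauerTensor_mk _ _ _ _).trans (Eq.trans ?_ (hB'' (e x)).symm)
  refine congrArg (brauerMk ((M ⊗ N : Rep.{u} k G).ρ.comp P.subtype)) (Subtype.ext ?_)
  exact (b.tensorProduct_apply' c (x.1.1, x.2.1)).symm

lemma isIso_brauerDual [Fact p.Prime] [CharP k p] (hP : IsPGroup p P) {M : Rep.{u} k G}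
    (hM : IsPPermutation p M) [Module.Finite k M] : IsIso (brauerDualHom P hP M) := by
  classical
  obtain ⟨X, _, b, hb⟩ := hM P hP
  have := Module.Finite.finite_basis b
  have := Fintype.ofFinite X
  obtain ⟨B, hB⟩ := exists_brauerBasis hP hb
  have hd : ∀ (h : P) (x : X), ((dualRep M).ρ.comp P.subtype) h (b.dualBasis x) =
      b.dualBasis (h • x) := fun h x => b.ext fun y => by
    change b.dualBasis x ((M.ρ.comp P.subtype) h⁻¹ (b y)) = _
    rw [hb, b.dualBasis_apply_self, b.dualBasis_apply_self]
    simp only [inv_smul_eq_iff]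
  obtain ⟨B', hB'⟩ := exists_brauerBasis (V := dualRep M) hP hd
  refine isIso_of_bijective (f := brauerDualHom P hP M) ?_
  refine bijective_of_basis B' B.dualBasis (Equiv.refl _) (brauerDual hP (M.ρ.comp P.subtype))
    fun x => B.ext fun y => ?_
  rw [hB', hB, Equiv.refl_apply, ← hB, B.dualBasis_apply_self, hB]
  change b.dualBasis x.1 (b y.1) = _
  rw [b.dualBasis_apply_self]
  simp only [Subtype.ext_iff]

lemma brauer_finite (M : Rep.{u} k G) [Module.Finite k M] :
    Module.Finite k (brauerRep P M) :=
  inferInstanceAs (Module.Finite k (BrauerQuotient (M.ρ.comp P.subtype)))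

/-- The Brauer construction preserves the trivial module. -/
def brauerUnitIso [Fact p.Prime] [CharP k p] (hP : IsPGroup p P) :
    brauerRep P (𝟙_ (Rep.{u} k G)) ≅ 𝟙_ (Rep.{u} k (G ⧸ P)) where
  hom := Rep.ofHom ⟨brauerLift (Submodule.subtype _) fun v hv =>
      traceSubmodule_le_ker hP (σ := Representation.trivial k P k) LinearMap.id (fun _ _ => rfl) hv,
    fun g => by
      obtain ⟨g, rfl⟩ := QuotientGroup.mk_surjective g
      exact brauer_hom_ext fun _ => rfl⟩
  inv := Rep.ofHom ⟨brauerMk (Representation.trivial k P k) ∘ₗ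
      LinearMap.id.codRestrict _ (fun _ _ => rfl), fun g => by
      obtain ⟨g, rfl⟩ := QuotientGroup.mk_surjective g
      rfl⟩
  hom_inv_id := brauer_rep_hom_ext P fun _ => rfl
  inv_hom_id := rfl

lemma brauer_pperm [Fact p.Prime] (hP : IsPGroup p P) (M : Rep.{u} k G) [Module.Finite k M]
    [CharP k p] (hM : IsPPermutation p M) : IsPPermutation p (brauerRep P M) := by
  intro Q hQ
  let S := Q.comap (QuotientGroup.mk' P)
  have hS : IsPGroup p S := by
    refine hQ.comap_of_ker_isPGroup _ ?_
    rwa [QuotientGroup.ker_mk']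
  have hPS : P ≤ S := fun g hg => by
    rw [Subgroup.mem_comap, QuotientGroup.mk'_apply, (QuotientGroup.eq_one_iff g).2 hg]
    exact one_mem Q
  obtain ⟨X, _, b, hb⟩ := hM S hS
  let _ : MulAction P X := MulAction.compHom X (Subgroup.inclusion hPS)
  have hbP : ∀ (h : P) (x : X), (M.ρ.comp P.subtype) h (b x) = b (h • x) := fun h x =>
    hb (Subgroup.inclusion hPS h) x
  have := Module.Finite.finite_basis b
  obtain ⟨B, hB⟩ := exists_brauerBasis hP hbP
  have hfix : ∀ (s : S) (x : MulAction.fixedPoints P X), s • x.1 ∈ MulAction.fixedPoints P X := by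
    intro s x h
    have h1 := x.2 (MulAut.conjNormal s.1⁻¹ h)
    change Subgroup.inclusion hPS _ • x.1 = x.1 at h1
    change Subgroup.inclusion hPS h • s • x.1 = s • x.1
    conv_rhs => rw [← h1]
    rw [← mul_smul, ← mul_smul]
    congr 1
    refine Subtype.ext ?_
    change h.1 * s.1 = s.1 * (MulAut.conjNormal s.1⁻¹ h).1
    rw [MulAut.conjNormal_apply]
    group
  have hq : ∀ q : Q, ∃ s : S, (s.1 : G ⧸ P) = q.1 := fun q => by
    obtain ⟨g, hg⟩ := QuotientGroup.mk_surjective q.1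
    exact ⟨⟨g, by rw [Subgroup.mem_comap, QuotientGroup.mk'_apply, hg]; exact q.2⟩, hg⟩
  choose r hr using hq
  have hact : ∀ (s t : S) (x : MulAction.fixedPoints P X), (s.1 : G ⧸ P) = t.1 →
      s • x.1 = t • x.1 := by
    intro s t x h
    rw [← inv_smul_eq_iff, ← mul_smul]
    exact x.2 ⟨(t⁻¹ * s).1, QuotientGroup.eq.1 h.symm⟩
  let _ : MulAction Q (MulAction.fixedPoints P X) :=
    { smul := fun q x => ⟨r q • x.1, hfix _ x⟩
      one_smul := fun x => Subtype.ext ((hact (r 1) 1 x (by rw [hr]; rfl)).trans (one_smul _ _))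
      mul_smul := fun q q' x => Subtype.ext ((hact (r (q * q')) (r q * r q') x
        (by rw [hr, Subgroup.coe_mul, Subgroup.coe_mul, QuotientGroup.mk_mul, hr, hr])).trans
        (mul_smul _ _ _)) }
  refine ⟨MulAction.fixedPoints P X, inferInstance, B, fun q x => ?_⟩
  change brauerRho P M.ρ q.1 (B x) = _
  rw [hB, hB, ← hr q, brauerRho_mk]
  refine congrArg (brauerMk _) (Subtype.ext ?_)
  exact hb (r q) x.1

lemma brauer_preserves [Fact p.Prime] [CharP k p] (hP : IsPGroup p P) :
    PreservesEndotrivial p (brauerFunctor (k := k) P) where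
  finite M _ := brauer_finite P M
  pperm M _ h := brauer_pperm P hP M h
  tensor := ⟨brauerTensorData P, fun _ _ hM hN _ _ => isIso_brauerTensor P hP hM hN⟩
  dual := ⟨brauerDualData P hP, fun _ hM _ => isIso_brauerDual P hP hM⟩
  unit := ⟨brauerUnitIso P hP⟩

end brauerPreserves

/-! ## Restriction, inflation, deflation -/

section res

universe w
variable {H : Type w} [Group H] (f : H →* G)

/-- Restriction along a group homomorphism commutes with tensor products. -/
def resTensorData : TensorData (Rep.resFunctor (k := k) f : Rep.{u} k G ⥤ Rep.{u} k H) where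
  μ _ _ := Rep.ofHom ⟨LinearMap.id, fun _ => rfl⟩
  μ_left _ _ := hom_ext_tensor fun _ _ => rfl
  μ_right _ _ _ _ := hom_ext_tensor fun _ _ => rfl

lemma resDual_comm (M : Rep.{u} k G) (h : H) :
    (dualRep M).ρ (f h) = (dualRep ((Rep.resFunctor f).obj M)).ρ h := by
  change Module.Dual.transpose (R := k) (M.ρ ((f h)⁻¹)) =
    Module.Dual.transpose (R := k) (M.ρ (f h⁻¹))
  exact congrArg (fun x => Module.Dual.transpose (R := k) (M.ρ x)) (map_inv f h).symm

/-- Restriction along a group homomorphism commutes with duals. -/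
def resDualData : DualData (Rep.resFunctor (k := k) f : Rep.{u} k G ⥤ Rep.{u} k H) where
  ν M := Rep.ofHom ⟨LinearMap.id, fun h => resDual_comm f M h⟩
  ν_nat _ := rfl

lemma res_preserves :
    PreservesEndotrivial p (Rep.resFunctor (k := k) f : Rep.{u} k G ⥤ Rep.{u} k H) where
  finite M h := h
  pperm M _ hM := by
    intro Q hQ
    obtain ⟨X, _, b, hb⟩ := hM (Q.map f) (hQ.map f)
    let g : Q →* Q.map f :=
      (f.comp Q.subtype).codRestrict (Q.map f) fun q => Subgroup.mem_map_of_mem f q.2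
    let _ : MulAction Q X := MulAction.compHom X g
    exact ⟨X, inferInstance, b, fun q x => hb (g q) x⟩
  tensor := ⟨resTensorData f, fun _ _ _ _ _ _ => isIso_of_bijective _ Function.bijective_id⟩
  dual := ⟨resDualData f, fun _ _ _ => isIso_of_bijective _ Function.bijective_id⟩
  unit := ⟨Iso.refl _⟩

end res

/-- The poset of normal `p`-subgroups of `G`, ordered by inclusion. -/
def NormalPSubgroup (p : ℕ) (G : Type v) [Group G] : Type v :=
  {P : Subgroup G // P.Normal ∧ IsPGroup p P}

namespace NormalPSubgroup

instance : PartialOrder (NormalPSubgroup p G) :=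
  inferInstanceAs (PartialOrder {P : Subgroup G // P.Normal ∧ IsPGroup p P})

instance [Finite G] : Fintype (NormalPSubgroup p G) :=
  have : Finite (NormalPSubgroup p G) :=
    inferInstanceAs (Finite {P : Subgroup G // P.Normal ∧ IsPGroup p P})
  Fintype.ofFinite _

instance : DecidableEq (NormalPSubgroup p G) := Classical.decEq _

instance : DecidableLE (NormalPSubgroup p G) := Classical.decRel _

instance : DecidableLT (NormalPSubgroup p G) := Classical.decRel _

instance [Finite G] : LocallyFiniteOrder (NormalPSubgroup p G) :=
  Fintype.toLocallyFiniteOrder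

instance (P : NormalPSubgroup p G) : P.1.Normal := P.2.1

end NormalPSubgroup

section maps

/-- Restriction of endotrivial complexes along a group homomorphism: `H` acts through `f`. -/
def restriction {H : Type*} [Group H] (f : H →* G) :
    EndotrivialGroup p k G →+ EndotrivialGroup p k H :=
  EndotrivialGroup.map (res_preserves f)

/-- The inflation `Inf^G_{G/P}`: the group `G` acts through `G → G / P`. -/
def inflation (P : NormalPSubgroup p G) :
    EndotrivialGroup p k (G ⧸ P.1) →+ EndotrivialGroup p k G :=
  restriction (QuotientGroup.mk' P.1)

/-- The inflation `Inf^{G/P}_{G/Q}` for `P ≤ Q`: the group `G / P` acts through the canonical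
surjection `G / P → G / Q`. -/
def inflationOfLE {P Q : NormalPSubgroup p G} (h : P ≤ Q) :
    EndotrivialGroup p k (G ⧸ Q.1) →+ EndotrivialGroup p k (G ⧸ P.1) :=
  restriction (QuotientGroup.map P.1 Q.1 (MonoidHom.id G) h)

/-- The deflation `Def^G_{G/P}`, which sends the class of `C` to the class of `C(P)`, the Brauer
construction at `P` applied degree by degree. -/
def deflation [Fact p.Prime] [CharP k p] [Finite G] (P : NormalPSubgroup p G) :
    EndotrivialGroup p k G →+ EndotrivialGroup p k (G ⧸ P.1) :=
  EndotrivialGroup.map (brauer_preserves P.1 P.2.2)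

end maps

/-- The faithful component `∂E_k(G)`: the intersection of the kernels of the deflations to `G / P`,
for `P` a nontrivial normal `p`-subgroup of `G`. -/
def faithfulComponent (p : ℕ) [Fact p.Prime] (k : Type u) [Field k] [CharP k p]
    (G : Type v) [Group G] [Finite G] : AddSubgroup (EndotrivialGroup p k G) :=
  ⨅ P : {P : NormalPSubgroup p G // P.1 ≠ ⊥}, (deflation P.1).ker

/-- The map `Φ : E_k(G) → ∏_P E_k(G / P)`. Its component at `P` sends `C` to the sum of
`μ(P, Q) • Inf^{G/P}_{G/Q} C(Q)` over the normal `p`-subgroups `Q` containing `P`, where `μ` is the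
Möbius function of the poset of normal `p`-subgroups of `G`. -/
def mobiusMap (p : ℕ) [Fact p.Prime] (k : Type u) [Field k] [CharP k p]
    (G : Type v) [Group G] [Finite G] :
    EndotrivialGroup p k G →+ ∀ P : NormalPSubgroup p G, EndotrivialGroup p k (G ⧸ P.1) where
  toFun C P := ∑ Q : {Q : NormalPSubgroup p G // P ≤ Q},
    IncidenceAlgebra.mu ℤ P Q.1 • inflationOfLE Q.2 (deflation Q.1 C)
  map_zero' := funext fun P => Finset.sum_eq_zero fun Q _ => by
    rw [map_zero, map_zero, smul_zero]
  map_add' C D := funext fun P => by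
    rw [Pi.add_apply, ← Finset.sum_add_distrib]
    refine Finset.sum_congr rfl fun Q _ => ?_
    rw [map_add, map_add, smul_add]

end

end EndotrivialComplex

open EndotrivialComplex

namespace EndotrivialComplex

noncomputable section

open CategoryTheory Limits MonoidalCategory

variable {k : Type u} [Field k] {G : Type v} [Group G] {p : ℕ}

/-! ## Relative traces and surjective homomorphisms -/

section traces

universe w
variable {H : Type v} [Group H] {H' : Type w} [Group H'] {V : Type u} [AddCommGroup V]
  [Module k V]

/-! The theorem is Möbius inversion on the poset of normal `p`-subgroups, fed by commutation rules
between inflation and deflation. Two properties of the Brauer construction give these rules.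

The first concerns restriction along `f : G → G'`: if `Q` maps onto `Q'`, then `(Res_f M)(Q)` is the
restriction of `M(Q')`. Invariants clearly agree, and traces agree by `traceSubmodule_comp`: a
proper subgroup of `Q` that still surjects onto `Q'` contributes a multiple of its index, which is
zero in characteristic `p`. Hence `Def_Q Inf_P` is an inflation of `Def_{QP/P}`: it is plain
inflation from `G/P` to `G/Q` if `Q ≤ P`, and it kills faithful classes if not, because then `QP/P`
is nontrivial.

The second is transitivity, `M(P)(Q/P) ≅ M(Q)` for `P ≤ Q`. It needs `p`-permutation modules: if `Q`
permutes a basis `X` of `M`, then the `P`-fixed points of `X` give a basis of `M(P)`, and the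
`Q/P`-fixed points among these are the `Q`-fixed points of `X` (`exists_basis_brauerRep`).

For (a), let `R/P` be a nontrivial normal `p`-subgroup of `G/P`. By both properties, deflating the
inflation of `C(Q)` at `R/P` gives a class that depends only on the join `QR`. The deflation of the
component of `Φ(C)` at `P` is therefore a sum of terms `μ(P,Q) g(QR)` with `P < R`, which vanishes
by Weisner's theorem (`sum_mu_smul_sup`).

For (b), exchange the order of summation. In `ΨΦ(C)` the coefficient of the inflation of `C(Q)` is
the sum of `μ(P,Q)` over `P ≤ Q`, so only `Q = 1` survives, and it returns `C`. In the component of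
`ΦΨ(c)` at `R`, the coefficient of the inflation of `c_P` is the sum of `μ(R,Q)` over `R ≤ Q ≤ P`,
so only `P = R` survives. -/

lemma traceSubmodule_of_subsingleton [Subsingleton H] (σ : Representation k H V) :
    traceSubmodule σ = ⊥ :=
  le_bot_iff.1 (traceSubmodule_le fun _ hQ _ _ => absurd (Subsingleton.elim _ _) hQ.ne)

variable [Finite H]

/-- Transitivity of traces through `S`: since `S` fixes `v`, the inner trace from `R` to `S` is
multiplication by the index of `R` in `S`. -/
lemma relTrace_of_le (σ : Representation k H V) {R S : Subgroup H} (hRS : R ≤ S) {v : V}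
    (hv : ∀ s ∈ S, σ s v = v) :
    relTrace σ R v = Nat.card (S ⧸ R.subgroupOf S) • relTrace σ S v := by
  let _ : Fintype (H ⧸ S) := Fintype.ofFinite _
  let _ : Fintype (H ⧸ R) := Fintype.ofFinite _
  let _ : Fintype (S ⧸ R.subgroupOf S) := Fintype.ofFinite _
  let E := Subgroup.quotientEquivProdOfLE hRS
  -- The first component of `E x` is the image of `x` in `H ⧸ S`, so the two representatives differ
  -- by an element of `S`, which fixes `v`.
  have hE : ∀ x : H ⧸ R, σ x.out v = σ (E x).1.out v := fun x => by
    have h : ((x.out : H) : H ⧸ S) = (((E x).1.out : H) : H ⧸ S) := by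
      rw [QuotientGroup.out_eq']
      conv_rhs => rw [← QuotientGroup.out_eq' x]
      rfl
    have h' : (E x).1.out⁻¹ * x.out ∈ S := QuotientGroup.eq.1 h.symm
    conv_lhs => rw [← mul_inv_cancel_left (E x).1.out x.out, map_mul, Module.End.mul_apply,
      hv _ h']
  rw [relTrace_eq σ R v (fun q hq => hv q (hRS hq)) (fun x => x.out)
      (fun x => QuotientGroup.out_eq' x),
    relTrace_eq σ S v hv (fun x => x.out) (fun x => QuotientGroup.out_eq' x),
    Fintype.sum_equiv E _ (fun y => σ y.1.out v) hE, Fintype.sum_prod_type, Finset.smul_sum]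
  refine Finset.sum_congr rfl fun y _ => ?_
  change ∑ _z : S ⧸ R.subgroupOf S, σ y.out v = _
  rw [Finset.sum_const, Finset.card_univ, Nat.card_eq_fintype_card]

/-- A surjection induces a bijection between the cosets of `f⁻¹(S)` and those of `S`. -/
lemma relTrace_comap (σ : Representation k H' V) {f : H →* H'} (hf : Function.Surjective f)
    (S : Subgroup H') {v : V} (hv : ∀ s ∈ S, σ s v = v) :
    relTrace (σ.comp f) (S.comap f) v = relTrace σ S v := by
  have : Finite H' := Finite.of_surjective f hf
  let _ : Fintype (H ⧸ S.comap f) := Fintype.ofFinite _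
  let _ : Fintype (H' ⧸ S) := Fintype.ofFinite _
  let φ : H ⧸ S.comap f → H' ⧸ S := Quotient.map' f fun a b h => by
    rw [QuotientGroup.leftRel_apply] at h ⊢
    rwa [← map_inv, ← map_mul]
  have hφ : Function.Bijective φ := by
    constructor
    · intro x y h
      obtain ⟨a, rfl⟩ := QuotientGroup.mk_surjective x
      obtain ⟨b, rfl⟩ := QuotientGroup.mk_surjective y
      have h' : (f a : H' ⧸ S) = f b := h
      rw [QuotientGroup.eq] at h' ⊢
      rwa [Subgroup.mem_comap, map_mul, map_inv]
    · intro y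
      obtain ⟨b, rfl⟩ := QuotientGroup.mk_surjective y
      obtain ⟨a, rfl⟩ := hf b
      exact ⟨a, rfl⟩
  let E := Equiv.ofBijective φ hφ
  -- The representatives for `H' ⧸ S` are taken to be images of those for the preimage, so that the
  -- two sums match term by term.
  rw [relTrace_eq (σ.comp f) _ v (fun q hq => hv (f q) hq) (fun x => x.out)
      (fun x => QuotientGroup.out_eq' x),
    relTrace_eq σ S v hv (fun y => f (E.symm y).out)]
  · refine Fintype.sum_equiv E _ _ fun x => ?_
    rw [Equiv.symm_apply_apply]
    rfl
  · intro y
    obtain ⟨x, rfl⟩ := E.surjective y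
    rw [Equiv.symm_apply_apply]
    conv_rhs => rw [← QuotientGroup.out_eq' x]
    rfl

/-- Proper subgroups of `H'` pull back to proper subgroups of `H`, which gives one inclusion. For
the other, a vector fixed by `R < H` is fixed by `f(R)`, so its trace from `R` is a multiple of its
trace from `f⁻¹(f(R))`, which equals the trace from `f(R)`. Only the case `f(R) = H'` needs the
characteristic. -/
lemma traceSubmodule_comp [Fact p.Prime] [CharP k p] (hH : IsPGroup p H)
    (σ : Representation k H' V) {f : H →* H'} (hf : Function.Surjective f) :
    traceSubmodule (σ.comp f) = traceSubmodule σ := by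
  refine le_antisymm ?_ ?_
  · refine traceSubmodule_le fun R hR v hv => ?_
    have hv' : ∀ s ∈ R.map f, σ s v = v := by
      rintro _ ⟨r, hr, rfl⟩
      exact hv r hr
    rw [relTrace_of_le (σ.comp f) (R.le_comap_map f) fun s hs => hv' (f s) hs]
    -- If `f(R)` is everything, there is no proper subgroup to take a trace from, but the multiple
    -- is then the index of `R` in the `p`-group `H`, which is zero in `k`.
    by_cases hS : R.map f = ⊤
    · have h0 := card_quotient_eq_zero (k := k) hH R hR
      have h1 : Nat.card (H ⧸ R) =
          Nat.card (((R.map f).comap f : Subgroup H) ⧸ R.subgroupOf ((R.map f).comap f)) := by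
        change R.index = R.relIndex _
        rw [hS, Subgroup.comap_top, Subgroup.relIndex_top_right]
      rw [← Nat.cast_smul_eq_nsmul k, ← h1, h0, zero_smul]
      exact zero_mem _
    · rw [relTrace_comap σ hf _ hv']
      exact Submodule.smul_of_tower_mem _ _ (relTrace_mem (lt_top_iff_ne_top.2 hS) hv')
  · refine traceSubmodule_le fun S hS v hv => ?_
    rw [← relTrace_comap σ hf S hv]
    refine relTrace_mem (lt_top_iff_ne_top.2 fun h => hS.ne ?_) fun q hq => hv (f q) hq
    rw [← Subgroup.map_comap_eq_self_of_surjective hf S, h, Subgroup.map_top_of_surjective f hf]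

/-- The coordinate at a fixed point is an `H`-invariant functional, so it kills traces. Conversely,
an invariant vector is congruent modulo traces to its part supported on fixed points. -/
lemma mem_traceSubmodule_iff [Fact p.Prime] [CharP k p] (hH : IsPGroup p H)
    {σ : Representation k H V} {X : Type u} [MulAction H X] [Finite X] {b : Module.Basis X k V}
    (hb : ∀ (h : H) x, σ h (b x) = b (h • x)) {v : V} (hv : ∀ h, σ h v = v) :
    v ∈ traceSubmodule σ ↔ ∀ x ∈ MulAction.fixedPoints H X, b.coord x v = 0 := by
  have := Fintype.ofFinite X
  have := Fintype.ofFinite (MulAction.fixedPoints H X)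
  refine ⟨fun h x hx => traceSubmodule_le_ker hH (b.coord x)
    (fun h w => by rw [coord_apply hb, hx]) h, fun h => ?_⟩
  have h1 := sub_mem_trace hb v hv
  rwa [Finset.sum_eq_zero fun x _ => by rw [h x.1 x.2, zero_smul], sub_zero] at h1

end traces

/-! ## Isomorphic functors on complexes of `p`-permutation modules -/

section functor

universe w
variable {H : Type w} [Group H]

/-- The natural isomorphism is required only on finitely generated `p`-permutation modules, which is
where the terms of `C` lie. The map `M(Q) → M(P)(Q/P)` is constructed only for such modules. -/
lemma nonempty_iso_mapC {A B : Rep.{u} k G ⥤ Rep.{u} k H} [A.Additive] [B.Additive]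
    (e : ∀ M : Rep.{u} k G, Module.Finite k M → IsPPermutation p M → (A.obj M ⟶ B.obj M))
    (he : ∀ M hM hM', IsIso (e M hM hM'))
    (nat : ∀ M N hM hM' hN hN' (f : M ⟶ N), A.map f ≫ e N hN hN' = e M hM hM' ≫ B.map f)
    (C : PPermComplex p k G) : Nonempty (mapC A C.X ≅ mapC B C.X) :=
  ⟨HomologicalComplex.Hom.isoOfComponents
    (fun n => @asIso _ _ _ _ (e (C.X.X n) (C.finite n) (C.pperm n)) (he _ _ _))
    fun i j _ => (nat _ _ _ _ _ _ (C.X.d i j)).symm⟩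

end functor

/-! ### Functoriality of restriction. -/

section restriction

universe w w'
variable {H : Type w} [Group H] {K : Type w'} [Group K]

lemma restriction_restriction (f : H →* G) (g : K →* H) (x : EndotrivialGroup p k G) :
    restriction g (restriction f x) = restriction (f.comp g) x := by
  obtain ⟨⟨C⟩, _⟩ := x
  exact Subtype.ext (HomotopyClass.mk_eq_mk.2 ⟨HomotopyEquiv.refl _⟩)

lemma restriction_id (x : EndotrivialGroup p k G) : restriction (MonoidHom.id G) x = x := by
  obtain ⟨⟨C⟩, _⟩ := x
  exact Subtype.ext (HomotopyClass.mk_eq_mk.2 ⟨HomotopyEquiv.refl _⟩)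

end restriction

/-! ## Deflation, restriction and inflation -/

section deflation

variable [Fact p.Prime] [CharP k p] [Finite G] {G' : Type v} [Group G'] [Finite G']

/-- The canonical map `M(Q') → (Res_f M)(Q)`, for `f : G → G'` and `Q' = f(Q)`. -/
def brauerResHom (f : G →* G') (Q : Subgroup G) [Q.Normal] (hQ : IsPGroup p Q) (Q' : Subgroup G')
    [Q'.Normal] (h : Q.map f = Q') (M : Rep.{u} k G') :
    (Rep.resFunctor (QuotientGroup.map Q Q' f (Subgroup.map_le_iff_le_comap.1 h.le))).obj
        (brauerRep Q' M) ⟶ brauerRep Q ((Rep.resFunctor f).obj M) :=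
  let F : Q →* Q' := (f.comp Q.subtype).codRestrict Q' fun q => h.le (Subgroup.mem_map_of_mem f q.2)
  Rep.ofHom ⟨brauerLift
    (brauerMk (((Rep.resFunctor f).obj M).ρ.comp Q.subtype) ∘ₗ
      (Submodule.subtype _).codRestrict _ fun v q => v.2 (F q))
    fun v hv => (brauerMk_eq_iff (w := 0)).2 (by
      -- Surjectivity of `Q → Q'` is what identifies the traces for `Q'` with those for `Q`.
      have hF : Function.Surjective F := by
        rintro ⟨x, hx⟩
        obtain ⟨q, hq, rfl⟩ := h.ge hx
        exact ⟨⟨q, hq⟩, rfl⟩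
      rw [ZeroMemClass.coe_zero, sub_zero]
      exact (traceSubmodule_comp hQ (M.ρ.comp Q'.subtype) hF).ge hv),
    fun g => by
      obtain ⟨g, rfl⟩ := QuotientGroup.mk_surjective g
      exact brauer_hom_ext fun _ => rfl⟩

/-- The group `Q` acts on `M` through its image `Q'`, so the invariants are the same subspace of
`M`. The trace subspaces coincide by `traceSubmodule_comp`. No permutation basis enters. -/
lemma isIso_brauerResHom (f : G →* G') (Q : Subgroup G) [Q.Normal] (hQ : IsPGroup p Q)
    (Q' : Subgroup G') [Q'.Normal] (h : Q.map f = Q') (M : Rep.{u} k G') :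
    IsIso (brauerResHom f Q hQ Q' h M) := by
  let F : Q →* Q' := (f.comp Q.subtype).codRestrict Q' fun q => h.le (Subgroup.mem_map_of_mem f q.2)
  have hF : Function.Surjective F := by
    rintro ⟨x, hx⟩
    obtain ⟨q, hq, rfl⟩ := h.ge hx
    exact ⟨⟨q, hq⟩, rfl⟩
  refine isIso_of_bijective _ ⟨?_, ?_⟩
  · intro x y hxy
    obtain ⟨v, rfl⟩ := brauerMk_surjective _ x
    obtain ⟨w, rfl⟩ := brauerMk_surjective _ y
    exact brauerMk_eq_iff.2 ((traceSubmodule_comp hQ (M.ρ.comp Q'.subtype) hF).le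
      (brauerMk_eq_iff.1 hxy))
  · intro x
    obtain ⟨v, rfl⟩ := brauerMk_surjective _ x
    refine ⟨brauerMk (M.ρ.comp Q'.subtype) ⟨v.1, fun q => ?_⟩, rfl⟩
    obtain ⟨q, rfl⟩ := hF q
    exact v.2 q

lemma brauerResHom_naturality (f : G →* G') (Q : Subgroup G) [Q.Normal] (hQ : IsPGroup p Q)
    (Q' : Subgroup G') [Q'.Normal] (h : Q.map f = Q') {M N : Rep.{u} k G'} (φ : M ⟶ N) :
    (Rep.resFunctor (QuotientGroup.map Q Q' f (Subgroup.map_le_iff_le_comap.1 h.le))).map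
        ((brauerFunctor Q').map φ) ≫ brauerResHom f Q hQ Q' h N =
      brauerResHom f Q hQ Q' h M ≫ (brauerFunctor Q).map ((Rep.resFunctor f).map φ) :=
  Rep.hom_ext (Representation.IntertwiningMap.ext (brauer_hom_ext fun _ => rfl))

lemma nonempty_iso_brauer_res (f : G →* G') (Q : Subgroup G) [Q.Normal] (hQ : IsPGroup p Q)
    (Q' : Subgroup G') [Q'.Normal] (h : Q.map f = Q') (C : PPermComplex p k G') :
    Nonempty (mapC (Rep.resFunctor (QuotientGroup.map Q Q' f (Subgroup.map_le_iff_le_comap.1 h.le)))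
      (mapC (brauerFunctor Q') C.X) ≅ mapC (brauerFunctor Q) (mapC (Rep.resFunctor f) C.X)) :=
  nonempty_iso_mapC
    (A := brauerFunctor Q' ⋙ Rep.resFunctor (QuotientGroup.map Q Q' f
      (Subgroup.map_le_iff_le_comap.1 h.le)))
    (B := Rep.resFunctor f ⋙ brauerFunctor Q)
    (fun M _ _ => brauerResHom f Q hQ Q' h M)
    (fun M _ _ => isIso_brauerResHom f Q hQ Q' h M)
    (fun _ _ _ _ _ _ φ => brauerResHom_naturality f Q hQ Q' h φ) C

/-- Applied to `G → G/P`, this rewrites the deflation at `Q` of an inflated class as an inflation of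
its deflation at `QP/P`. -/
lemma deflation_restriction (f : G →* G') (Q : NormalPSubgroup p G) (Q' : NormalPSubgroup p G')
    (h : Q.1.map f = Q'.1) (x : EndotrivialGroup p k G') :
    deflation Q (restriction f x) =
      restriction (QuotientGroup.map Q.1 Q'.1 f (Subgroup.map_le_iff_le_comap.1 h.le))
        (deflation Q' x) := by
  obtain ⟨⟨C⟩, _⟩ := x
  obtain ⟨e⟩ := nonempty_iso_brauer_res f Q.1 Q.2.2 Q'.1 h C
  exact Subtype.ext (HomotopyClass.mk_eq_mk.2 ⟨(HomotopyEquiv.ofIso e).symm⟩)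

/-- The canonical map `M → M(P)`, for `P` the trivial group. -/
def brauerBotHom (P : Subgroup G) [P.Normal] (hP : P = ⊥) (M : Rep.{u} k G) :
    M ⟶ (Rep.resFunctor (QuotientGroup.mk' P)).obj (brauerRep P M) :=
  Rep.ofHom ⟨brauerMk (M.ρ.comp P.subtype) ∘ₗ LinearMap.id.codRestrict _ (fun v q => by
      subst hP
      rw [Subsingleton.elim q 1, map_one]
      rfl), fun g => rfl⟩

/-- For the trivial group every vector is invariant, and there are no proper subgroups to take
traces from. -/
lemma isIso_brauerBotHom (P : Subgroup G) [P.Normal] (hP : P = ⊥) (M : Rep.{u} k G) :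
    IsIso (brauerBotHom P hP M) := by
  have : Subsingleton P := by
    subst hP
    infer_instance
  refine isIso_of_bijective _ ⟨fun v w h => ?_, fun x => ?_⟩
  · have h' : v - w ∈ traceSubmodule (M.ρ.comp P.subtype) := brauerMk_eq_iff.1 h
    rw [traceSubmodule_of_subsingleton] at h'
    exact sub_eq_zero.1 h'
  · obtain ⟨v, rfl⟩ := brauerMk_surjective _ x
    exact ⟨v.1, rfl⟩

/-- Triviality of `P` is an equation because the lemma is also applied to images in `G/P` of
subgroups of `P`, which are trivial but not by definition. -/
lemma inflation_deflation_of_eq_bot (P : NormalPSubgroup p G) (hP : P.1 = ⊥)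
    (x : EndotrivialGroup p k G) : inflation P (deflation P x) = x := by
  obtain ⟨⟨C⟩, _⟩ := x
  obtain ⟨e⟩ := nonempty_iso_mapC (A := 𝟭 _)
    (B := brauerFunctor P.1 ⋙ Rep.resFunctor (QuotientGroup.mk' P.1))
    (fun M _ _ => brauerBotHom P.1 hP M) (fun M _ _ => isIso_brauerBotHom P.1 hP M)
    (fun M N _ _ _ _ f => rfl) C
  exact Subtype.ext (HomotopyClass.mk_eq_mk.2 ⟨HomotopyEquiv.ofIso e.symm⟩)

end deflation

/-! ### Transitivity of the Brauer construction: permutation bases. -/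

section transitivity

lemma invariants_le_invariants (P Q : Subgroup G) {V : Type u} [AddCommGroup V] [Module k V] (ρ : Representation k G V)
    (hPQ : P ≤ Q) : Representation.invariants (ρ.comp Q.subtype) ≤
      Representation.invariants (ρ.comp P.subtype) :=
  fun _ hv g => hv ⟨g, hPQ g.2⟩

variable (P Q : Subgroup G) [P.Normal] (Q' : Subgroup (G ⧸ P))

/-- Here `Q'` plays the role of `Q/P`. The two are linked by an equation on preimages, so that `Q`
may be presented as a preimage or as a join, without transport along equalities of subgroups. The
inclusion holds because `P` is the kernel of the projection. -/
lemma le_comap_of_comap_eq (h : Q'.comap (QuotientGroup.mk' P) = Q) : P ≤ Q := by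
  rw [← h]
  exact (QuotientGroup.ker_mk' P).ge.trans (MonoidHom.ker_le_comap _ _)

variable [Finite G]

/-- The canonical map `M^Q → M(P)`, for `P ≤ Q`. -/
def invariantsToBrauer {V : Type u} [AddCommGroup V] [Module k V] (ρ : Representation k G V)
    (hPQ : P ≤ Q) : Representation.invariants (ρ.comp Q.subtype) →ₗ[k]
      BrauerQuotient (ρ.comp P.subtype) :=
  brauerMk (ρ.comp P.subtype) ∘ₗ Submodule.inclusion (invariants_le_invariants P Q ρ hPQ)

lemma invariantsToBrauer_mem {V : Type u} [AddCommGroup V] [Module k V] (ρ : Representation k G V)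
    (h : Q'.comap (QuotientGroup.mk' P) = Q) (v : Representation.invariants (ρ.comp Q.subtype)) :
    invariantsToBrauer P Q ρ (le_comap_of_comap_eq P Q Q' h) v ∈
      Representation.invariants ((brauerRho P ρ).comp Q'.subtype) := by
  rintro ⟨x, hx⟩
  obtain ⟨g, rfl⟩ := QuotientGroup.mk_surjective x
  refine (brauerRho_mk P ρ g _).trans (congrArg _ (Subtype.ext ?_))
  exact v.2 ⟨g, h.le hx⟩

/-- Let `X` be a basis of `M` permuted by `Q`. Its `P`-fixed points `Y` index a basis of `M(P)`; as
`P` is normal, `Q` acts on `Y`, and `P` acts trivially there, so `Q'` acts. The fixed points of `Q'`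
on `Y` are those of `Q` on `X`. The last two clauses compare basis vectors and coordinates at these
fixed points: the former describe the map `M(Q) → M(P)(Q')` on a basis, the latter detect traces. -/
lemma exists_basis_brauerRep [Fact p.Prime] [CharP k p] (hQ : IsPGroup p Q)
    (h : Q'.comap (QuotientGroup.mk' P) = Q) {M : Rep.{u} k G} (hM : IsPPermutation p M)
    [Module.Finite k M] :
    ∃ (X Y : Type u) (_ : Finite X) (_ : Finite Y) (_ : MulAction Q X) (_ : MulAction Q' Y)
      (b : Module.Basis X k M) (B : Module.Basis Y k (brauerRep P M))
      (e : MulAction.fixedPoints Q X ≃ MulAction.fixedPoints Q' Y),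
      (∀ (q : Q) x, M.ρ q (b x) = b (q • x)) ∧ (∀ (q : Q') y, brauerRho P M.ρ q (B y) = B (q • y)) ∧
      (∀ x (hx : b x ∈ Representation.invariants (M.ρ.comp P.subtype)),
        ∀ hf : x ∈ MulAction.fixedPoints Q X, B (e ⟨x, hf⟩).1 = brauerMk _ ⟨b x, hx⟩) ∧
      ∀ x (v : Representation.invariants (M.ρ.comp P.subtype)),
        B.coord (e x).1 (brauerMk _ v) = b.coord x.1 v.1 := by
  have hPQ := le_comap_of_comap_eq P Q Q' h
  have hP : IsPGroup p P := hQ.to_le hPQ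
  obtain ⟨X, _, b, hb⟩ := hM Q hQ
  let _ : MulAction P X := MulAction.compHom X (Subgroup.inclusion hPQ)
  have hbP : ∀ (h : P) (x : X), (M.ρ.comp P.subtype) h (b x) = b (h • x) := fun h x =>
    hb (Subgroup.inclusion hPQ h) x
  have := Module.Finite.finite_basis b
  obtain ⟨B, hB⟩ := exists_brauerBasis hP hbP
  -- Normality of `P`: for `h` in `P`, `h s = s (s⁻¹ h s)`, and `s⁻¹ h s` lies in `P`.
  have hfix : ∀ (s : Q) (x : MulAction.fixedPoints P X), s • x.1 ∈ MulAction.fixedPoints P X := by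
    intro s x h
    have h1 := x.2 (MulAut.conjNormal s.1⁻¹ h)
    change Subgroup.inclusion hPQ _ • x.1 = x.1 at h1
    change Subgroup.inclusion hPQ h • s • x.1 = s • x.1
    conv_rhs => rw [← h1]
    rw [← mul_smul, ← mul_smul]
    congr 1
    refine Subtype.ext ?_
    change h.1 * s.1 = s.1 * (MulAut.conjNormal s.1⁻¹ h).1
    rw [MulAut.conjNormal_apply]
    group
  have hq : ∀ q : Q', ∃ s : Q, (s.1 : G ⧸ P) = q.1 := fun q => by
    obtain ⟨g, hg⟩ := QuotientGroup.mk_surjective q.1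
    refine ⟨⟨g, h.le ?_⟩, hg⟩
    rw [Subgroup.mem_comap, QuotientGroup.mk'_apply, hg]
    exact q.2
  choose r hr using hq
  -- Two lifts of the same element of `Q'` differ by an element of `P`, which acts trivially on the
  -- `P`-fixed points. The action through the chosen lifts `r` is thus independent of the choice,
  -- and multiplicative although `r` need not be.
  have hact : ∀ (s t : Q) (x : MulAction.fixedPoints P X), (s.1 : G ⧸ P) = t.1 →
      s • x.1 = t • x.1 := by
    intro s t x h
    rw [← inv_smul_eq_iff, ← mul_smul]
    exact x.2 ⟨(t⁻¹ * s).1, QuotientGroup.eq.1 h.symm⟩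
  let _ : MulAction Q' (MulAction.fixedPoints P X) :=
    { smul := fun q x => ⟨r q • x.1, hfix _ x⟩
      one_smul := fun x => Subtype.ext ((hact (r 1) 1 x (by rw [hr]; rfl)).trans (one_smul _ _))
      mul_smul := fun q q' x => Subtype.ext ((hact (r (q * q')) (r q * r q') x
        (by rw [hr, Subgroup.coe_mul, Subgroup.coe_mul, QuotientGroup.mk_mul, hr, hr])).trans
        (mul_smul _ _ _)) }
  -- In the inverse direction, `s` in `Q` acts on a `P`-fixed point as the chosen lift of its class
  -- does, so a point fixed by `Q'` is fixed by `Q`.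
  let e : MulAction.fixedPoints Q X ≃ MulAction.fixedPoints Q' (MulAction.fixedPoints P X) :=
    { toFun := fun x => ⟨⟨x.1, fun g => x.2 (Subgroup.inclusion hPQ g)⟩, fun q =>
        Subtype.ext (x.2 (r q))⟩
      invFun := fun y => ⟨y.1.1, fun s => by
        have hs : (s.1 : G ⧸ P) ∈ Q' := h.ge s.2
        exact (hact s (r ⟨_, hs⟩) y.1 (hr ⟨_, hs⟩).symm).trans
          (congrArg Subtype.val (y.2 ⟨_, hs⟩))⟩
      left_inv := fun _ => rfl
      right_inv := fun _ => rfl }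
  refine ⟨X, MulAction.fixedPoints P X, inferInstance, inferInstance, inferInstance, inferInstance,
    b, B, e, hb, fun q x => ?_, fun x hx hf => hB _, fun x v => ?_⟩
  · rw [hB, hB, ← hr q, brauerRho_mk]
    refine congrArg (brauerMk _) (Subtype.ext ?_)
    exact hb (r q) x.1
  · classical
    have := Fintype.ofFinite X
    -- The coordinate at `x` is a `P`-invariant functional on `M`, hence kills traces and descends
    -- to `M(P)`. The descended functional agrees with the coordinate of `B` on basis vectors.
    have hc : B.coord (e x).1 = brauerLift (b.coord x.1 ∘ₗ Submodule.subtype _) fun v hv =>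
        traceSubmodule_le_ker hP (b.coord x.1)
          (fun h v => (coord_apply hbP _ h v).trans
            (congrArg (b.coord · v) ((e x).1.2 h⁻¹))) hv := by
      refine B.ext fun y => ?_
      rw [B.coord_apply, B.repr_self_apply, hB]
      change _ = b.coord x.1 (b y.1)
      rw [b.coord_apply, b.repr_self_apply]
      exact if_congr Subtype.ext_iff rfl rfl
    rw [hc]
    rfl

variable [Q.Normal] [Q'.Normal]

/-- The canonical isomorphism `(G / P) / Q' → G / Q`, for `Q' = Q / P`. -/
def quotientQuotientHom (h : Q'.comap (QuotientGroup.mk' P) = Q) : (G ⧸ P) ⧸ Q' →* G ⧸ Q :=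
  QuotientGroup.lift Q' (QuotientGroup.map P Q (MonoidHom.id G) (le_comap_of_comap_eq P Q Q' h))
    fun x hx => by
      obtain ⟨g, rfl⟩ := QuotientGroup.mk_surjective x
      exact (QuotientGroup.eq_one_iff g).2 (h.le hx)

end transitivity

/-! ### Transitivity of the Brauer construction: the isomorphism. -/

section transitivity

variable [Fact p.Prime] [CharP k p] [Finite G] (P Q : Subgroup G) [P.Normal] [Q.Normal]
  (Q' : Subgroup (G ⧸ P)) [Q'.Normal]

/-- By `mem_traceSubmodule_iff`, both conditions say that the coordinates at fixed points vanish,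
and these coordinates correspond under the bijection `e`. -/
lemma mem_traceSubmodule_brauerRho_iff (hQ : IsPGroup p Q)
    (h : Q'.comap (QuotientGroup.mk' P) = Q) {M : Rep.{u} k G} (hM : IsPPermutation p M)
    [Module.Finite k M] (v : Representation.invariants (M.ρ.comp Q.subtype)) :
    invariantsToBrauer P Q M.ρ (le_comap_of_comap_eq P Q Q' h) v ∈
      traceSubmodule ((brauerRho P M.ρ).comp Q'.subtype) ↔
    v.1 ∈ traceSubmodule (M.ρ.comp Q.subtype) := by
  obtain ⟨X, Y, _, _, _, _, b, B, e, hb, hB, -, hc⟩ := exists_basis_brauerRep P Q Q' hQ h hM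
  -- `Q'` is the image of `Q` in `G ⧸ P`.
  have hQ' : IsPGroup p Q' := by
    rw [← Subgroup.map_comap_eq_self_of_surjective (QuotientGroup.mk'_surjective P) Q', h]
    exact hQ.map _
  rw [mem_traceSubmodule_iff (σ := M.ρ.comp Q.subtype) hQ hb v.2,
    mem_traceSubmodule_iff (σ := (brauerRho P M.ρ).comp Q'.subtype) hQ' hB
      (invariantsToBrauer_mem P Q Q' M.ρ h v)]
  constructor
  · intro H x hx
    exact (hc ⟨x, hx⟩ (Submodule.inclusion (invariants_le_invariants P Q M.ρ
      (le_comap_of_comap_eq P Q Q' h)) v)).symm.trans (H _ (e ⟨x, hx⟩).2)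
  · intro H y hy
    obtain ⟨x, hx⟩ := e.surjective ⟨y, hy⟩
    have := hc x (Submodule.inclusion (invariants_le_invariants P Q M.ρ
      (le_comap_of_comap_eq P Q Q' h)) v)
    rw [hx] at this
    exact this.trans (H _ x.2)

/-- The linear map underlying the canonical map `M(Q) → M(P)(Q / P)`. -/
def brauerTrans (hQ : IsPGroup p Q) (h : Q'.comap (QuotientGroup.mk' P) = Q) (M : Rep.{u} k G)
    [Module.Finite k M] (hM : IsPPermutation p M) :
    BrauerQuotient (M.ρ.comp Q.subtype) →ₗ[k] BrauerQuotient ((brauerRho P M.ρ).comp Q'.subtype) :=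
  brauerLift (brauerMk ((brauerRho P M.ρ).comp Q'.subtype) ∘ₗ
    (invariantsToBrauer P Q M.ρ (le_comap_of_comap_eq P Q Q' h)).codRestrict _
      (invariantsToBrauer_mem P Q Q' M.ρ h)) fun v hv => (brauerMk_eq_iff (w := 0)).2 (by
    rw [ZeroMemClass.coe_zero, sub_zero]
    exact (mem_traceSubmodule_brauerRho_iff P Q Q' hQ h hM v).2 hv)

/-- The canonical map `M(Q) → M(P)(Q / P)`. -/
def brauerTransHom (hQ : IsPGroup p Q) (h : Q'.comap (QuotientGroup.mk' P) = Q) (M : Rep.{u} k G)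
    [Module.Finite k M] (hM : IsPPermutation p M) :
    (Rep.resFunctor (quotientQuotientHom P Q Q' h)).obj (brauerRep Q M) ⟶
      brauerRep Q' (brauerRep P M) :=
  Rep.ofHom ⟨brauerTrans P Q Q' hQ h M hM, fun g => by
    obtain ⟨g, rfl⟩ := QuotientGroup.mk_surjective g
    obtain ⟨g, rfl⟩ := QuotientGroup.mk_surjective g
    exact brauer_hom_ext fun _ => rfl⟩

/-- The map carries the basis of `M(Q)` indexed by `Q`-fixed points to the basis of `M(P)(Q')`
indexed by `Q'`-fixed points. -/
lemma isIso_brauerTransHom (hQ : IsPGroup p Q) (h : Q'.comap (QuotientGroup.mk' P) = Q)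
    (M : Rep.{u} k G) [Module.Finite k M] (hM : IsPPermutation p M) :
    IsIso (brauerTransHom P Q Q' hQ h M hM) := by
  obtain ⟨X, Y, _, _, _, _, b, B, e, hb, hB, he, -⟩ := exists_basis_brauerRep P Q Q' hQ h hM
  have hQ' : IsPGroup p Q' := by
    rw [← Subgroup.map_comap_eq_self_of_surjective (QuotientGroup.mk'_surjective P) Q', h]
    exact hQ.map _
  obtain ⟨b', hb'⟩ := exists_brauerBasis (σ := M.ρ.comp Q.subtype) hQ hb
  obtain ⟨B', hB'⟩ := exists_brauerBasis (σ := (brauerRho P M.ρ).comp Q'.subtype) hQ' hB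
  refine isIso_of_bijective _ (bijective_of_basis b' B' e
    (brauerTrans P Q Q' hQ h M hM) fun x => ?_)
  rw [hb', hB']
  exact congrArg (brauerMk _) (Subtype.ext (he x.1 _ x.2).symm)

lemma brauerTransHom_naturality (hQ : IsPGroup p Q) (h : Q'.comap (QuotientGroup.mk' P) = Q)
    {M N : Rep.{u} k G} [Module.Finite k M] (hM : IsPPermutation p M) [Module.Finite k N]
    (hN : IsPPermutation p N) (φ : M ⟶ N) :
    (Rep.resFunctor (quotientQuotientHom P Q Q' h)).map ((brauerFunctor Q).map φ) ≫
        brauerTransHom P Q Q' hQ h N hN =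
      brauerTransHom P Q Q' hQ h M hM ≫ (brauerFunctor Q').map ((brauerFunctor P).map φ) :=
  Rep.hom_ext (Representation.IntertwiningMap.ext (brauer_hom_ext fun _ => rfl))

lemma nonempty_iso_brauer_brauer (hQ : IsPGroup p Q) (h : Q'.comap (QuotientGroup.mk' P) = Q)
    (C : PPermComplex p k G) :
    Nonempty (mapC (Rep.resFunctor (quotientQuotientHom P Q Q' h)) (mapC (brauerFunctor Q) C.X) ≅
      mapC (brauerFunctor Q') (mapC (brauerFunctor P) C.X)) :=
  nonempty_iso_mapC
    (A := brauerFunctor Q ⋙ Rep.resFunctor (quotientQuotientHom P Q Q' h))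
    (B := brauerFunctor P ⋙ brauerFunctor Q')
    (fun M _ hM => brauerTransHom P Q Q' hQ h M hM)
    (fun M _ hM => isIso_brauerTransHom P Q Q' hQ h M hM)
    (fun _ _ _ hM _ hN φ => brauerTransHom_naturality P Q Q' hQ h hM hN φ) C

lemma deflation_deflation (P Q : NormalPSubgroup p G) (Q' : NormalPSubgroup p (G ⧸ P.1))
    (h : Q'.1.comap (QuotientGroup.mk' P.1) = Q.1) (x : EndotrivialGroup p k G) :
    deflation Q' (deflation P x) =
      restriction (quotientQuotientHom P.1 Q.1 Q'.1 h) (deflation Q x) := by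
  obtain ⟨⟨C⟩, _⟩ := x
  obtain ⟨e⟩ := nonempty_iso_brauer_brauer P.1 Q.1 Q'.1 Q.2.2 h C
  exact Subtype.ext (HomotopyClass.mk_eq_mk.2 ⟨(HomotopyEquiv.ofIso e).symm⟩)

end transitivity

/-! ## The lattice of normal `p`-subgroups -/

namespace NormalPSubgroup

/-- The product of two normal `p`-subgroups is again one; joins are needed for Weisner's theorem.
The structure extends the existing partial order, so the Möbius function is unchanged. -/
instance : SemilatticeSup (NormalPSubgroup p G) :=
  { (inferInstance : PartialOrder (NormalPSubgroup p G)) with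
    sup := fun P Q => ⟨P.1 ⊔ Q.1, inferInstance, P.2.2.to_sup_of_normal_left Q.2.2⟩
    le_sup_left := fun P Q => (le_sup_left : P.1 ≤ P.1 ⊔ Q.1)
    le_sup_right := fun P Q => (le_sup_right : Q.1 ≤ P.1 ⊔ Q.1)
    sup_le := fun P Q R (h : P.1 ≤ R.1) (h' : Q.1 ≤ R.1) => (sup_le h h' : P.1 ⊔ Q.1 ≤ R.1) }

instance : OrderBot (NormalPSubgroup p G) where
  bot := ⟨⊥, inferInstance, IsPGroup.of_bot⟩
  bot_le P := (bot_le : ⊥ ≤ P.1)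

/-- The image under a surjective homomorphism. -/
def map {G' : Type*} [Group G'] (f : G →* G') (hf : Function.Surjective f)
    (P : NormalPSubgroup p G) : NormalPSubgroup p G' :=
  ⟨P.1.map f, P.2.1.map f hf, P.2.2.map f⟩

/-- The preimage in `G` of a normal `p`-subgroup of `G / P`. -/
def comapMk (P : NormalPSubgroup p G) (R : NormalPSubgroup p (G ⧸ P.1)) : NormalPSubgroup p G :=
  ⟨R.1.comap (QuotientGroup.mk' P.1), inferInstance, R.2.2.comap_of_ker_isPGroup _ (by
    rw [QuotientGroup.ker_mk']
    exact P.2.2)⟩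

/-- If `P` were the whole preimage of `R`, then `R`, as the image of its preimage, would be trivial.
The strict inequality is the hypothesis of Weisner's theorem. -/
lemma lt_comapMk [Finite G] (P : NormalPSubgroup p G) (R : NormalPSubgroup p (G ⧸ P.1)) (hR : R.1 ≠ ⊥) :
    P < P.comapMk R := by
  refine lt_of_le_of_ne (le_comap_of_comap_eq P.1 _ R.1 rfl) fun h => hR ?_
  have h' : P.1 = R.1.comap (QuotientGroup.mk' P.1) := congrArg Subtype.val h
  rw [← Subgroup.map_comap_eq_self_of_surjective (QuotientGroup.mk'_surjective P.1) R.1, ← h',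
    Subgroup.map_eq_bot_iff, QuotientGroup.ker_mk']

end NormalPSubgroup

/-! ### Weisner's theorem for the Möbius function of a finite join-semilattice. -/

section weisner

variable {α A : Type*} [SemilatticeSup α] [Fintype α] [LocallyFiniteOrder α] [DecidableEq α]
  [DecidableLE α] [AddCommGroup A]

open IncidenceAlgebra

/-- Induction on `s`. If `r ≤ s`, then `x ≤ s` exactly when `x ⊔ r ≤ s`, so the sum of `μ(a,x)` over
the interval from `a` to `s`, which vanishes since `a < s`, splits according to `t = x ⊔ r`. The
parts with `t < s` vanish by induction, leaving the part `t = s`. If `r ≤ s` fails, the sum is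
empty. -/
lemma sum_mu_sup_eq_zero {a r : α} (har : a < r) (s : α) :
    ∑ x with a ≤ x ∧ x ⊔ r = s, mu ℤ a x = 0 := by
  induction s using WellFoundedLT.induction with
  | ind s ih =>
    by_cases hrs : r ≤ s
    · have h1 : ∑ x ∈ Finset.Icc a s, mu ℤ a x = 0 := by
        rw [sum_Icc_mu_right, if_neg (har.trans_le hrs).ne]
      rw [← Finset.sum_fiberwise (g := fun x => x ⊔ r), Finset.sum_eq_single s] at h1
      · rw [← h1]
        refine Finset.sum_congr (Finset.ext fun x => ?_) fun _ _ => rfl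
        simp only [Finset.mem_filter, Finset.mem_univ, true_and, Finset.mem_Icc]
        exact ⟨fun h => ⟨⟨h.1, h.2 ▸ le_sup_left⟩, h.2⟩, fun h => ⟨h.1.1, h.2⟩⟩
      · intro t _ hts
        by_cases hle : t ≤ s
        · rw [← ih t (lt_of_le_of_ne hle hts)]
          refine Finset.sum_congr (Finset.ext fun x => ?_) fun _ _ => rfl
          simp only [Finset.mem_filter, Finset.mem_univ, true_and, Finset.mem_Icc]
          exact ⟨fun h => ⟨h.1.1, h.2⟩, fun h => ⟨⟨h.1, (h.2 ▸ le_sup_left : x ≤ t).trans hle⟩, h.2⟩⟩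
        · refine Finset.sum_eq_zero fun x hx => ?_
          rw [Finset.mem_filter, Finset.mem_Icc] at hx
          exact absurd (hx.2 ▸ sup_le hx.1.2 hrs) hle
      · exact fun h => absurd (Finset.mem_univ s) h
    · refine Finset.sum_eq_zero fun x hx => ?_
      rw [Finset.mem_filter] at hx
      exact absurd (hx.2.2 ▸ le_sup_right) hrs

/-- Weisner's theorem. -/
lemma sum_mu_smul_sup {a r : α} (har : a < r) (g : α → A) :
    ∑ x : {x // a ≤ x}, mu ℤ a x.1 • g (x.1 ⊔ r) = 0 := by
  rw [← Finset.sum_subtype (p := fun x => a ≤ x) (Finset.univ.filter fun x => a ≤ x) (by simp)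
    (fun x => mu ℤ a x • g (x ⊔ r)),
    ← Finset.sum_fiberwise (g := fun x => x ⊔ r)]
  -- On the fibre `x ⊔ r = s` the vector is constantly `g s`, and the coefficients sum to zero.
  refine Finset.sum_eq_zero fun s _ => ?_
  rw [Finset.filter_filter]
  refine Eq.trans (Finset.sum_congr rfl fun x hx => ?_) (Finset.sum_smul.symm.trans
    ((congrArg (· • g s) (sum_mu_sup_eq_zero har s)).trans (zero_smul _ _)))
  rw [(Finset.mem_filter.1 hx).2.2]

end weisner

/-! ## The splitting -/

section splitting

open IncidenceAlgebra

lemma inflationOfLE_refl (P : NormalPSubgroup p G) (x : EndotrivialGroup p k (G ⧸ P.1)) :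
    inflationOfLE (le_refl P) x = x := by
  have h : QuotientGroup.map P.1 P.1 (MonoidHom.id G) (le_refl P.1) = MonoidHom.id _ :=
    QuotientGroup.monoidHom_ext _ rfl
  change restriction (QuotientGroup.map P.1 P.1 (MonoidHom.id G) (le_refl P.1)) x = x
  rw [h, restriction_id]

lemma inflationOfLE_trans {P Q R : NormalPSubgroup p G} (hPQ : P ≤ Q) (hQR : Q ≤ R)
    (x : EndotrivialGroup p k (G ⧸ R.1)) :
    inflationOfLE hPQ (inflationOfLE hQR x) = inflationOfLE (hPQ.trans hQR) x := by
  refine (restriction_restriction _ _ x).trans ?_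
  refine congrArg (fun f => restriction f x) ?_
  exact QuotientGroup.monoidHom_ext _ rfl

lemma inflation_inflationOfLE {P Q : NormalPSubgroup p G} (hPQ : P ≤ Q)
    (x : EndotrivialGroup p k (G ⧸ Q.1)) :
    inflation P (inflationOfLE hPQ x) = inflation Q x :=
  restriction_restriction _ _ x

variable [Fact p.Prime] [CharP k p] [Finite G]

lemma mem_faithfulComponent_iff {x : EndotrivialGroup p k G} :
    x ∈ faithfulComponent p k G ↔
      ∀ P : NormalPSubgroup p G, P.1 ≠ ⊥ → deflation P x = 0 := by
  rw [faithfulComponent, AddSubgroup.mem_iInf]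
  exact ⟨fun h P hP => h ⟨P, hP⟩, fun h P => h P.1 P.2⟩

/-- Here the image of `Q` in `G/P` is trivial, so deflating there loses nothing. -/
lemma deflation_inflation_of_le {P Q : NormalPSubgroup p G} (hQP : Q ≤ P)
    (x : EndotrivialGroup p k (G ⧸ P.1)) :
    deflation Q (inflation P x) = inflationOfLE hQP x := by
  let Q' := Q.map (QuotientGroup.mk' P.1) (QuotientGroup.mk'_surjective P.1)
  have hQ' : Q'.1 = ⊥ := by
    refine (Subgroup.map_eq_bot_iff _).2 ?_
    rw [QuotientGroup.ker_mk']
    exact hQP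
  refine (deflation_restriction _ Q Q' rfl x).trans ?_
  -- Writing `x` as the inflation of its deflation at the trivial subgroup `Q'` turns both sides
  -- into restrictions of one class, along homomorphisms that agree on `G`.
  conv_rhs => rw [← inflation_deflation_of_eq_bot Q' hQ' x]
  refine Eq.trans ?_ (restriction_restriction _ _ _).symm
  refine congrArg (fun f => restriction f _) ?_
  exact QuotientGroup.monoidHom_ext _ rfl

/-- Now the image of `Q` in `G/P` is a nontrivial normal `p`-subgroup, at which a faithful class
deflates to zero. -/
lemma deflation_inflation_of_not_le {P Q : NormalPSubgroup p G} (hQP : ¬ Q ≤ P)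
    {x : EndotrivialGroup p k (G ⧸ P.1)} (hx : x ∈ faithfulComponent p k (G ⧸ P.1)) :
    deflation Q (inflation P x) = 0 := by
  let Q' := Q.map (QuotientGroup.mk' P.1) (QuotientGroup.mk'_surjective P.1)
  have hQ' : Q'.1 ≠ ⊥ := fun h => hQP (by
    have h' := (Subgroup.map_eq_bot_iff _).1 h
    rw [QuotientGroup.ker_mk'] at h'
    exact h')
  refine (deflation_restriction _ Q Q' rfl x).trans ?_
  rw [mem_faithfulComponent_iff.1 hx Q' hQ', map_zero]

/-- The canonical map `(G / P) / R → G / S`, if `S` contains the preimage of `R`. -/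
def quotientHom (P : NormalPSubgroup p G) (R : NormalPSubgroup p (G ⧸ P.1))
    (S : NormalPSubgroup p G) (h : P.comapMk R ≤ S) : (G ⧸ P.1) ⧸ R.1 →* G ⧸ S.1 :=
  (QuotientGroup.map (P.comapMk R).1 S.1 (MonoidHom.id G) h).comp
    (quotientQuotientHom P.1 (P.comapMk R).1 R.1 rfl)

/-- The image of `R` in `G/Q` has preimage `Q ⊔ P.comapMk R` in `G`, so transitivity yields a
deflation at this join. What matters is that the right side depends on `Q` only through the join. -/
lemma deflation_inflationOfLE_deflation {P Q : NormalPSubgroup p G} (hPQ : P ≤ Q)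
    (R : NormalPSubgroup p (G ⧸ P.1)) (x : EndotrivialGroup p k G) :
    deflation R (inflationOfLE hPQ (deflation Q x)) =
      restriction (quotientHom P R (Q ⊔ P.comapMk R) le_sup_right)
        (deflation (Q ⊔ P.comapMk R) x) := by
  let f := QuotientGroup.map P.1 Q.1 (MonoidHom.id G) hPQ
  have hf : Function.Surjective f := fun y => by
    obtain ⟨g, rfl⟩ := QuotientGroup.mk_surjective y
    exact ⟨g, rfl⟩
  let R' := R.map f hf
  -- The image of `R` in `G/Q` is also the image of its preimage in `G`, and pulling back along `G →
  -- G/Q` joins the kernel `Q`.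
  have hR' : R'.1.comap (QuotientGroup.mk' Q.1) = (Q ⊔ P.comapMk R).1 := by
    have h1 : R'.1 = (P.comapMk R).1.map (QuotientGroup.mk' Q.1) := by
      change R.1.map f = (R.1.comap (QuotientGroup.mk' P.1)).map (f.comp (QuotientGroup.mk' P.1))
      rw [← Subgroup.map_map,
        Subgroup.map_comap_eq_self_of_surjective (QuotientGroup.mk'_surjective P.1)]
    rw [h1, Subgroup.comap_map_eq, QuotientGroup.ker_mk', sup_comm]
    rfl
  refine (deflation_restriction f R R' rfl (deflation Q x)).trans ?_
  rw [deflation_deflation Q (Q ⊔ P.comapMk R) R' hR', restriction_restriction]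
  -- Two homomorphisms out of `(G/P)/R` are equal once they agree on `G`.
  refine congrArg (fun f => restriction f _) ?_
  exact QuotientGroup.monoidHom_ext _ (QuotientGroup.monoidHom_ext _ rfl)

lemma mobiusMap_mem_faithfulComponent (C : EndotrivialGroup p k G) (P : NormalPSubgroup p G) :
    mobiusMap p k G C P ∈ faithfulComponent p k (G ⧸ P.1) := by
  refine mem_faithfulComponent_iff.2 fun R hR => ?_
  -- The default value `0` is never reached: `g` is evaluated only at joins with `P.comapMk R`.
  let g : NormalPSubgroup p G → EndotrivialGroup p k ((G ⧸ P.1) ⧸ R.1) := fun S =>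
    if h : P.comapMk R ≤ S then restriction (quotientHom P R S h) (deflation S C) else 0
  have hg : ∀ Q : {Q : NormalPSubgroup p G // P ≤ Q},
      deflation R (mu ℤ P Q.1 • inflationOfLE Q.2 (deflation Q.1 C)) =
        mu ℤ P Q.1 • g (Q.1 ⊔ P.comapMk R) := fun Q => by
    rw [map_zsmul, deflation_inflationOfLE_deflation]
    simp only [g]
    rw [dif_pos]
  change deflation R (∑ Q : {Q : NormalPSubgroup p G // P ≤ Q}, _) = 0
  rw [map_sum, Finset.sum_congr rfl fun Q _ => hg Q]
  exact sum_mu_smul_sup (P.lt_comapMk R hR) g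

lemma sum_inflation_mobiusMap (C : EndotrivialGroup p k G) :
    ∑ P, inflation P (mobiusMap p k G C P) = C := by
  -- The sum over `Q ≥ P` is extended by zero to all `Q`, so that the index set no longer depends on
  -- `P` and the two sums can be exchanged.
  have h1 : ∀ P, inflation P (mobiusMap p k G C P) =
      ∑ Q, if P ≤ Q then mu ℤ P Q • inflation Q (deflation Q C) else 0 := fun P => by
    change inflation P (∑ Q : {Q : NormalPSubgroup p G // P ≤ Q}, _) = _
    rw [map_sum, ← Finset.sum_filter,
      Finset.sum_subtype (p := fun Q => P ≤ Q) (Finset.univ.filter fun Q => P ≤ Q) (by simp)]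
    refine Finset.sum_congr rfl fun Q _ => ?_
    rw [map_zsmul, inflation_inflationOfLE]
  rw [Finset.sum_congr rfl fun P _ => h1 P, Finset.sum_comm, Finset.sum_eq_single ⊥]
  · rw [Finset.sum_eq_single ⊥, if_pos le_rfl, mu_self, one_smul,
      inflation_deflation_of_eq_bot ⊥ rfl]
    · exact fun P _ hP => if_neg fun h => hP (le_bot_iff.1 h)
    · exact fun h => absurd (Finset.mem_univ _) h
  · intro Q _ hQ
    -- For `Q ≠ ⊥` the coefficient is the sum of `μ(P,Q)` over the interval from `⊥` to `Q`, which
    -- is zero.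
    rw [← Finset.sum_filter, ← Finset.sum_smul]
    refine (congrArg (· • _) (Eq.trans (Finset.sum_congr (Finset.ext fun P => ?_) fun _ _ => rfl)
      ((sum_Icc_mu_left (𝕜 := ℤ) ⊥ Q).trans (if_neg hQ.symm)))).trans (zero_smul _ _)
    simp
  · exact fun h => absurd (Finset.mem_univ _) h

lemma mobiusMap_sum_inflation (c : ∀ P : NormalPSubgroup p G, EndotrivialGroup p k (G ⧸ P.1))
    (hc : ∀ P, c P ∈ faithfulComponent p k (G ⧸ P.1)) (R : NormalPSubgroup p G) :
    mobiusMap p k G (∑ P, inflation P (c P)) R = c R := by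
  -- The default value is harmless: if `R ≤ P` fails, then no `Q` satisfies `R ≤ Q ≤ P`, and `g P`
  -- gets an empty sum as coefficient.
  let g : NormalPSubgroup p G → EndotrivialGroup p k (G ⧸ R.1) := fun P =>
    if h : R ≤ P then inflationOfLE h (c P) else 0
  have h1 : ∀ Q : {Q : NormalPSubgroup p G // R ≤ Q},
      mu ℤ R Q.1 • inflationOfLE Q.2 (deflation Q.1 (∑ P, inflation P (c P))) =
        ∑ P, if Q.1 ≤ P then mu ℤ R Q.1 • g P else 0 := fun Q => by
    rw [map_sum, map_sum, Finset.smul_sum]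
    refine Finset.sum_congr rfl fun P _ => ?_
    -- For `Q ≤ P` the class `c P` survives as an inflation; otherwise its faithfulness makes the
    -- deflation at `Q` vanish.
    split_ifs with h
    · rw [deflation_inflation_of_le h, inflationOfLE_trans]
      simp only [g]
      rw [dif_pos]
    · rw [deflation_inflation_of_not_le h (hc P), map_zero, smul_zero]
  change ∑ Q : {Q : NormalPSubgroup p G // R ≤ Q}, _ = _
  rw [Finset.sum_congr rfl fun Q _ => h1 Q,
    ← Finset.sum_subtype (p := fun Q => R ≤ Q) (Finset.univ.filter fun Q => R ≤ Q) (by simp)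
      (fun Q => ∑ P, if Q ≤ P then mu ℤ R Q • g P else 0), Finset.sum_comm,
    Finset.sum_eq_single R]
  · rw [Finset.sum_eq_single R, if_pos le_rfl, mu_self, one_smul]
    · simp only [g]
      rw [dif_pos le_rfl, inflationOfLE_refl]
    · intro Q hQ hQR
      exact if_neg fun h => hQR (le_antisymm h (Finset.mem_filter.1 hQ).2)
    · exact fun h => absurd (Finset.mem_filter.2 ⟨Finset.mem_univ _, le_rfl⟩) h
  · intro P _ hP
    -- For `P ≠ R` the coefficient of `g P` is the sum of `μ(R,Q)` over the interval from `R` to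
    -- `P`, which is zero.
    rw [← Finset.sum_filter, ← Finset.sum_smul, Finset.filter_filter]
    refine (congrArg (· • _) (Eq.trans (Finset.sum_congr (Finset.ext fun Q => ?_) fun _ _ => rfl)
      ((sum_Icc_mu_right (𝕜 := ℤ) R P).trans (if_neg hP.symm)))).trans (zero_smul _ _)
    simp
  · exact fun h => absurd (Finset.mem_univ _) h

/-- The isomorphism `E_k(G) ≃ ∏_P ∂E_k(G / P)`. -/
def mobiusEquiv (p : ℕ) [Fact p.Prime] (k : Type u) [Field k] [CharP k p]
    (G : Type v) [Group G] [Finite G] : EndotrivialGroup p k G ≃+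
      (∀ P : NormalPSubgroup p G, faithfulComponent p k (G ⧸ P.1)) where
  toFun C P := ⟨mobiusMap p k G C P, mobiusMap_mem_faithfulComponent C P⟩
  invFun c := ∑ P, inflation P (c P).1
  left_inv C := sum_inflation_mobiusMap C
  right_inv c := funext fun R =>
    Subtype.ext (mobiusMap_sum_inflation (fun P => (c P).1) (fun P => (c P).2) R)
  map_add' C D := funext fun P => Subtype.ext (congrFun (map_add (mobiusMap p k G) C D) P)

end splitting

end

end EndotrivialComplex

theorem mainTheorem4 (p : ℕ) [Fact p.Prime] (k : Type u) [Field k] [CharP k p]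
    (G : Type v) [Group G] [Finite G] :
    (∀ (C : EndotrivialGroup p k G) (P : NormalPSubgroup p G),
      mobiusMap p k G C P ∈ faithfulComponent p k (G ⧸ P.1)) ∧
    ∃ Φ : EndotrivialGroup p k G ≃+
        (∀ P : NormalPSubgroup p G, faithfulComponent p k (G ⧸ P.1)),
      (∀ (C : EndotrivialGroup p k G) (P : NormalPSubgroup p G),
        (Φ C P : EndotrivialGroup p k (G ⧸ P.1)) = mobiusMap p k G C P) ∧
      ∀ c : (∀ P : NormalPSubgroup p G, faithfulComponent p k (G ⧸ P.1)),
        Φ.symm c = ∑ P : NormalPSubgroup p G,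
          inflation P (c P : EndotrivialGroup p k (G ⧸ P.1)) :=
  ⟨mobiusMap_mem_faithfulComponent, mobiusEquiv p k G, fun _ _ => rfl, fun _ => rfl⟩
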